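/- Let $0<q<1$. For real $\alpha$ put $$F(\alpha;q)=\sum_{n=-\infty}^{\infty}\frac{1}{q^{\,n+\alpha}+q^{-n-\alpha}},$$ and write $(z;q)_\infty=\prod_{i\ge 0}(1-zq^{i})$ and $(z_1,\dots,z_N;q)_\infty=(z_1;q)_\infty\cdots(z_N;q)_\infty$. For $0<k<1$ let $K=K(k)=\int_0^{\pi/2}\frac{d\theta}{\sqrt{1-k^2\sin^2\theta}}$ be the complete elliptic integral of the first kind, $k'=\sqrt{1-k^2}$ and $K'=K(k')$; let $\mathrm{dn}(u;k)=\sqrt{1-k^2\sin^2\varphi}$, where $u=\int_0^{\varphi}\frac{d\theta}{\sqrt{1-k^2\sin^2\theta}}$ ($u\in\mathbb{R}$), be the Jacobi elliptic function of modulus $k$. There is exactly one $k\in(0,1)$ with $q=\exp(-\pi K'/K)$. For every real $\alpha$ the series $F(\alpha;q)$ converges absolutely, and $$F(\alpha;q)=\frac{1}{q^{\alpha}+q^{-\alpha}}\;\frac{(-q^{1+2\alpha},\,-q^{1-2\alpha},\,q^2,\,q^2;\,q^2)_\infty}{(-q^{2+2\alpha},\,-q^{2-2\alpha},\,q,\,q;\,q^2)_\infty};$$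 moreover, for the $k\in(0,1)$ with $q=\exp(-\pi K'/K)$, $$F(\alpha;q)=\frac{K}{\pi}\,\mathrm{dn}(2\alpha K';k').$$ -/

import Mathlib

/-- The `q`-shifted factorial `(z; q)_n = (1 - z) (1 - z q) ⋯ (1 - z q ^ (n - 1))`. -/
noncomputable def qShiftedFactorial (z q : ℝ) (n : ℕ) : ℝ :=
  ∏ i ∈ Finset.range n, (1 - z * q ^ i)

/-- The infinite `q`-shifted factorial `(z; q)_∞ = ∏_{i ≥ 0} (1 - z q ^ i)`. -/
noncomputable def qShiftedFactorialInf (z q : ℝ) : ℝ :=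
  ∏' i : ℕ, (1 - z * q ^ i)

/-- For `|q| < 1` the infinite product converges. -/
theorem multipliable_qShiftedFactorialInf (z : ℝ) {q : ℝ} (hq : |q| < 1) :
    Multipliable fun i : ℕ => 1 - z * q ^ i := by
  have h : Summable fun i : ℕ => ‖-(z * q ^ i)‖ := by
    simpa [abs_mul, abs_pow] using
      (summable_geometric_of_lt_one (abs_nonneg q) hq).mul_left |z|
  simpa [sub_eq_add_neg] using multipliable_one_add_of_summable h

/-- For `|q| < 1`, `(z; q)_∞` is the limit of `(z; q)_n`. -/
theorem tendsto_qShiftedFactorial (z : ℝ) {q : ℝ} (hq : |q| < 1) :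
    Filter.Tendsto (qShiftedFactorial z q) Filter.atTop (nhds (qShiftedFactorialInf z q)) :=
  (multipliable_qShiftedFactorialInf z hq).hasProd.tendsto_prod_nat

/-- The incomplete elliptic integral of the first kind with modulus `k`,
`∫_0^φ dθ / √(1 - k² sin² θ)`. -/
noncomputable def ellipticIntegralF (φ k : ℝ) : ℝ :=
  ∫ θ in (0 : ℝ)..φ, 1 / Real.sqrt (1 - k ^ 2 * Real.sin θ ^ 2)

/-- The complete elliptic integral of the first kind `K(k)`. -/
noncomputable def ellipticIntegralK (k : ℝ) : ℝ :=
  ellipticIntegralF (Real.pi / 2) k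

/-- The complementary modulus `k' = √(1 - k²)`. -/
noncomputable def complementaryModulus (k : ℝ) : ℝ :=
  Real.sqrt (1 - k ^ 2)

/-- The complementary complete elliptic integral `K' = K(k')`. -/
noncomputable def ellipticIntegralK' (k : ℝ) : ℝ :=
  ellipticIntegralK (complementaryModulus k)

/-- For `|k| < 1` the incomplete integral is a bijection of the real line onto itself, so that the
Jacobi amplitude is well defined. -/
theorem ellipticIntegralF_bijective {k : ℝ} (hk : |k| < 1) :
    Function.Bijective fun φ => ellipticIntegralF φ k := by
  have hk2 : k ^ 2 < 1 := (sq_lt_one_iff_abs_lt_one k).2 hk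
  have hpos : ∀ θ : ℝ, 0 < 1 - k ^ 2 * Real.sin θ ^ 2 := fun θ => by
    nlinarith [Real.sin_sq_le_one θ, sq_nonneg k, sq_nonneg (Real.sin θ)]
  have hle : ∀ θ : ℝ, 1 - k ^ 2 * Real.sin θ ^ 2 ≤ 1 := fun θ => by
    nlinarith [mul_nonneg (sq_nonneg k) (sq_nonneg (Real.sin θ))]
  have hc : Continuous fun θ : ℝ => 1 / Real.sqrt (1 - k ^ 2 * Real.sin θ ^ 2) :=
    continuous_const.div (by fun_prop) fun θ => (Real.sqrt_pos.2 (hpos θ)).ne'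
  have hone : ∀ θ : ℝ, 1 ≤ 1 / Real.sqrt (1 - k ^ 2 * Real.sin θ ^ 2) := fun θ => by
    rw [le_div_iff₀ (Real.sqrt_pos.2 (hpos θ)), one_mul]
    exact Real.sqrt_le_one.2 (hle θ)
  have hgrow : ∀ a b : ℝ, a ≤ b → b - a ≤ ellipticIntegralF b k - ellipticIntegralF a k := by
    intro a b hab
    unfold ellipticIntegralF
    rw [intervalIntegral.integral_interval_sub_left (hc.intervalIntegrable _ _)
      (hc.intervalIntegrable _ _)]
    have := intervalIntegral.integral_mono_on hab (intervalIntegrable_const (c := (1 : ℝ)))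
      (hc.intervalIntegrable (μ := MeasureTheory.volume) a b) fun θ _ => hone θ
    simpa using this
  have h0 : ellipticIntegralF 0 k = 0 := by simp [ellipticIntegralF]
  have hcont : Continuous fun φ => ellipticIntegralF φ k :=
    intervalIntegral.continuous_primitive (fun a b => hc.intervalIntegrable a b) 0
  refine ⟨StrictMono.injective fun a b hab => ?_, hcont.surjective ?_ ?_⟩
  · have := hgrow a b hab.le
    change ellipticIntegralF a k < ellipticIntegralF b k
    linarith
  · refine Filter.tendsto_atTop_mono' _ ?_ Filter.tendsto_id
    filter_upwards [Filter.eventually_ge_atTop (0 : ℝ)] with x hx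
    have := hgrow 0 x hx
    simp only [id]
    linarith
  · refine Filter.tendsto_atBot_mono' _ ?_ Filter.tendsto_id
    filter_upwards [Filter.eventually_le_atBot (0 : ℝ)] with x hx
    have := hgrow x 0 hx
    simp only [id]
    linarith

/-- The Jacobi amplitude `am(u; k)`: the inverse function of the incomplete elliptic integral
`φ ↦ ∫_0^φ dθ / √(1 - k² sin² θ)`. -/
noncomputable def jacobiAm (u k : ℝ) : ℝ :=
  Function.invFun (fun φ => ellipticIntegralF φ k) u

/-- The Jacobi elliptic function `dn(u; k) = √(1 - k² sin² am(u; k))` of a real argument `u` and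
modulus `k`. -/
noncomputable def jacobiDn (u k : ℝ) : ℝ :=
  Real.sqrt (1 - k ^ 2 * Real.sin (jacobiAm u k) ^ 2)

/-- The general term `1 / (q ^ (n + α) + q ^ (-n - α))` of the bilateral series. -/
noncomputable def bilateralTerm (α q : ℝ) (n : ℤ) : ℝ :=
  1 / (q ^ ((n : ℝ) + α) + q ^ (-(n : ℝ) - α))

/-- The bilateral sum `F(α; q) = ∑_{n ∈ ℤ} 1 / (q ^ (n + α) + q ^ (-n - α))`. -/
noncomputable def bilateralF (α q : ℝ) : ℝ :=
  ∑' n : ℤ, bilateralTerm α q n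

/-!
Write `q = exp (-x)`. Then `F(α; q)` is half of the secant sum `f(α) = ∑_n sech (x (n + α))`, and
it is compared throughout with the alternating sum `g(α) = ∑_n (-1)ⁿ sech (x (n + α))`; both are
`sechSum ε x α`, with `ε = 1` and `ε = -1`.

*Product formula.* A finite product with poles at `-q ^ (-2 j)` is expanded in partial fractions
(`partialFraction`, by induction, one pole at a time). After centring the poles
(`partialFraction_symmetric`) the coefficients are, up to the factor `(ε q)ⁿ`, products of two
bounded ratios of finite `q`-factorials, so dominated convergence gives the bilateral series
(`sechSum_mul_eq_product`). The case `ε = 1` is the product for `F`;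
the case `ε = -1` shows that `g > 0` on `(-1/2, 1/2)`.

*Differential equation.* Multiply two secant series and sum along diagonals. The addition formulas
for `sech u * sech v` and `sech u * sech v ^ 2` evaluate the sum along each diagonal, the first
being a telescoping series. So `f² - ∑ sech²` and `g² - ∑ sech²` are constant (`sechSum_sq`), and
`∑ sech³` is a combination of `f * ∑ sech²` and `f` (`sechSum_one_mul_tsum_sq`). Hence
`f² = g² + f(1/2)²` (`sechSum_one_sq`), and `f'' = β f - 2 x² f³`, where
`β = x² (f(0)² + f(1/2)²)` follows from the first integral at the critical points `0` and `1/2`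
(`hasDerivAt_sechSumDeriv`). This is the equation of a rescaled `dn`, so with
`k = f(1/2) / f(0)` uniqueness gives `f(α) = f(0) dn (x f(0) α; k')` (`sechSum_one_eq_jacobiDn`).

*The two periods.* The first zero of `g` is at `1/2`, which identifies `K(k') = x f(0) / 2`
(`ellipticIntegralK'_sechModulus`). Splitting the sums into even and odd terms shows that
`(f(0), g(0))` undergoes one step of the arithmetic-geometric mean iteration when `x` is doubled,
and both tend to `1` as `x → ∞`. As `K(k) = f(0) ∫ dθ / √(f(0)² cos² θ + g(0)² sin² θ)` over
`[0, π/2]`, Gauss's transformation (`gaussIntegral_agm`) yields `K(k) = f(0) π / 2`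
(`ellipticIntegralK_sechModulus`). So `exp (-π K' / K) = q`, and `k` is the only such modulus since
`K` is strictly increasing (`nome_injOn`).
-/

/-! ### The elliptic integral and the Jacobi amplitude -/

section Elliptic

variable {k : ℝ}

theorem one_sub_sq_mul_sin_sq_pos (hk : |k| < 1) (θ : ℝ) : 0 < 1 - k ^ 2 * Real.sin θ ^ 2 := by
  have hk2 : k ^ 2 < 1 := (sq_lt_one_iff_abs_lt_one k).2 hk
  nlinarith [Real.sin_sq_le_one θ, sq_nonneg k, sq_nonneg (Real.sin θ)]

theorem continuous_ellipticIntegrand (hk : |k| < 1) :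
    Continuous fun θ : ℝ => 1 / Real.sqrt (1 - k ^ 2 * Real.sin θ ^ 2) :=
  continuous_const.div (by fun_prop) fun θ =>
    (Real.sqrt_pos.2 (one_sub_sq_mul_sin_sq_pos hk θ)).ne'

theorem hasDerivAt_ellipticIntegralF (hk : |k| < 1) (φ : ℝ) :
    HasDerivAt (fun φ => ellipticIntegralF φ k) (1 / Real.sqrt (1 - k ^ 2 * Real.sin φ ^ 2)) φ :=
  intervalIntegral.integral_hasDerivAt_right
    ((continuous_ellipticIntegrand hk).intervalIntegrable _ _)
    ((continuous_ellipticIntegrand hk).stronglyMeasurableAtFilter _ _)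
    (continuous_ellipticIntegrand hk).continuousAt

theorem ellipticIntegralF_zero : ellipticIntegralF 0 k = 0 := by simp [ellipticIntegralF]

theorem strictMono_ellipticIntegralF (hk : |k| < 1) :
    StrictMono fun φ => ellipticIntegralF φ k :=
  strictMono_of_hasDerivAt_pos (hasDerivAt_ellipticIntegralF hk) fun φ =>
    one_div_pos.2 (Real.sqrt_pos.2 (one_sub_sq_mul_sin_sq_pos hk φ))

theorem ellipticIntegralK_pos (hk : |k| < 1) : 0 < ellipticIntegralK k := by
  have := strictMono_ellipticIntegralF hk (show (0 : ℝ) < Real.pi / 2 by positivity)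
  simpa [ellipticIntegralF_zero, ellipticIntegralK] using this

theorem ellipticIntegralF_jacobiAm (hk : |k| < 1) (u : ℝ) :
    ellipticIntegralF (jacobiAm u k) k = u :=
  Function.rightInverse_invFun (ellipticIntegralF_bijective hk).2 u

theorem jacobiAm_ellipticIntegralF (hk : |k| < 1) (φ : ℝ) :
    jacobiAm (ellipticIntegralF φ k) k = φ :=
  Function.leftInverse_invFun (ellipticIntegralF_bijective hk).1 φ

theorem jacobiAm_zero (hk : |k| < 1) : jacobiAm 0 k = 0 := by
  simpa [ellipticIntegralF_zero] using jacobiAm_ellipticIntegralF hk 0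

theorem strictMono_jacobiAm (hk : |k| < 1) : StrictMono fun u => jacobiAm u k := by
  intro u v huv
  refine (strictMono_ellipticIntegralF hk).lt_iff_lt.1 ?_
  simpa only [ellipticIntegralF_jacobiAm hk] using huv

theorem continuous_jacobiAm (hk : |k| < 1) : Continuous fun u => jacobiAm u k :=
  (strictMono_jacobiAm hk).monotone.continuous_of_surjective fun φ =>
    ⟨_, jacobiAm_ellipticIntegralF hk φ⟩

theorem jacobiDn_sq (hk : |k| < 1) (u : ℝ) :
    jacobiDn u k ^ 2 = 1 - k ^ 2 * Real.sin (jacobiAm u k) ^ 2 :=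
  Real.sq_sqrt (one_sub_sq_mul_sin_sq_pos hk _).le

theorem jacobiDn_pos (hk : |k| < 1) (u : ℝ) : 0 < jacobiDn u k :=
  Real.sqrt_pos.2 (one_sub_sq_mul_sin_sq_pos hk _)

theorem jacobiDn_zero (hk : |k| < 1) : jacobiDn 0 k = 1 := by
  simp [jacobiDn, jacobiAm_zero hk]

theorem hasDerivAt_jacobiAm (hk : |k| < 1) (u : ℝ) :
    HasDerivAt (fun u => jacobiAm u k) (jacobiDn u k) u := by
  have h := HasDerivAt.of_local_left_inverse (continuous_jacobiAm hk).continuousAt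
    (hasDerivAt_ellipticIntegralF hk (jacobiAm u k))
    (one_div_pos.2 (Real.sqrt_pos.2 (one_sub_sq_mul_sin_sq_pos hk _))).ne'
    (Filter.Eventually.of_forall (ellipticIntegralF_jacobiAm hk))
  simpa [jacobiDn] using h

/-- `dn' = -k² sn cn`, with `sn = sin am` and `cn = cos am`. -/
theorem hasDerivAt_jacobiDn (hk : |k| < 1) (u : ℝ) :
    HasDerivAt (fun u => jacobiDn u k)
      (-k ^ 2 * Real.sin (jacobiAm u k) * Real.cos (jacobiAm u k)) u := by
  have h := ((((hasDerivAt_jacobiAm hk u).sin.pow 2).const_mul (k ^ 2)).const_sub 1).sqrt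
    (one_sub_sq_mul_sin_sq_pos hk (jacobiAm u k)).ne'
  refine h.congr_deriv ?_
  have hd := (jacobiDn_pos hk u).ne'
  change _ / (2 * jacobiDn u k) = _
  field_simp
  simp
  ring

/-- `dn'' = (2 - k²) dn - 2 dn³`. -/
theorem hasDerivAt_deriv_jacobiDn (hk : |k| < 1) (u : ℝ) :
    HasDerivAt (fun u => -k ^ 2 * Real.sin (jacobiAm u k) * Real.cos (jacobiAm u k))
      ((2 - k ^ 2) * jacobiDn u k - 2 * jacobiDn u k ^ 3) u := by
  have ham := hasDerivAt_jacobiAm hk u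
  have h := (ham.sin.const_mul (-k ^ 2)).mul ham.cos
  refine h.congr_deriv ?_
  have h1 := jacobiDn_sq hk u
  have h2 := Real.sin_sq_add_cos_sq (jacobiAm u k)
  linear_combination (2 * jacobiDn u k) * h1 - k ^ 2 * jacobiDn u k * h2

theorem ellipticIntegralK_strictMonoOn : StrictMonoOn ellipticIntegralK (Set.Ico 0 1) := by
  intro k hk l hl hkl
  have hk1 : |k| < 1 := by rw [abs_of_nonneg hk.1]; exact hk.2
  have hl1 : |l| < 1 := by rw [abs_of_nonneg hl.1]; exact hl.2
  have hsq : k ^ 2 < l ^ 2 := pow_lt_pow_left₀ hkl hk.1 two_ne_zero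
  refine intervalIntegral.integral_lt_integral_of_continuousOn_of_le_of_exists_lt (by positivity)
    (continuous_ellipticIntegrand hk1).continuousOn (continuous_ellipticIntegrand hl1).continuousOn
    (fun θ _ => ?_) ⟨Real.pi / 2, ⟨by positivity, le_rfl⟩, ?_⟩
  · refine one_div_le_one_div_of_le (Real.sqrt_pos.2 (one_sub_sq_mul_sin_sq_pos hl1 θ))
      (Real.sqrt_le_sqrt ?_)
    nlinarith [sq_nonneg (Real.sin θ)]
  · refine one_div_lt_one_div_of_lt (Real.sqrt_pos.2 (one_sub_sq_mul_sin_sq_pos hl1 _))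
      (Real.sqrt_lt_sqrt (one_sub_sq_mul_sin_sq_pos hl1 _).le ?_)
    simpa using hsq

theorem complementaryModulus_mem (hk : k ∈ Set.Ioo (0 : ℝ) 1) :
    complementaryModulus k ∈ Set.Ioo (0 : ℝ) 1 := by
  have h : 0 < k ^ 2 ∧ k ^ 2 < 1 :=
    ⟨pow_pos hk.1 2, pow_lt_one₀ hk.1.le hk.2 two_ne_zero⟩
  refine ⟨Real.sqrt_pos.2 (by linarith), ?_⟩
  rw [complementaryModulus, Real.sqrt_lt' one_pos]
  linarith

/-- The nome `exp (-π K' / K)` determines the modulus. -/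
theorem nome_injOn :
    Set.InjOn (fun k => Real.exp (-Real.pi * ellipticIntegralK' k / ellipticIntegralK k))
      (Set.Ioo 0 1) := by
  refine StrictMonoOn.injOn fun k hk l hl hkl => ?_
  have abs_lt {m : ℝ} (hm : m ∈ Set.Ioo (0 : ℝ) 1) : |m| < 1 := by
    rw [abs_of_pos hm.1]; exact hm.2
  have hk' := complementaryModulus_mem hk
  have hl' := complementaryModulus_mem hl
  have h1 : ellipticIntegralK k < ellipticIntegralK l :=
    ellipticIntegralK_strictMonoOn ⟨hk.1.le, hk.2⟩ ⟨hl.1.le, hl.2⟩ hkl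
  have h2 : ellipticIntegralK' l < ellipticIntegralK' k := by
    refine ellipticIntegralK_strictMonoOn ⟨hl'.1.le, hl'.2⟩ ⟨hk'.1.le, hk'.2⟩ ?_
    refine Real.sqrt_lt_sqrt ?_ ?_
    · nlinarith [hl.1, hl.2]
    · nlinarith [hk.1, hl.1]
  have h3 : ellipticIntegralK' l / ellipticIntegralK l <
      ellipticIntegralK' k / ellipticIntegralK k :=
    div_lt_div₀ h2 h1.le (ellipticIntegralK_pos (abs_lt hk')).le (ellipticIntegralK_pos (abs_lt hk))
  refine Real.exp_lt_exp.2 ?_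
  rw [mul_div_assoc, mul_div_assoc]
  nlinarith [Real.pi_pos]

end Elliptic

/-! ### Gauss's transformation of the complete elliptic integral -/

/-- The complete elliptic integral in the homogeneous form used by Gauss,
`∫_0^{π/2} dθ / √(a² cos² θ + b² sin² θ)`. -/
noncomputable def gaussIntegral (a b : ℝ) : ℝ :=
  ∫ θ in (0 : ℝ)..(Real.pi / 2), 1 / √(a ^ 2 * Real.cos θ ^ 2 + b ^ 2 * Real.sin θ ^ 2)

section Gauss

variable {a b : ℝ}

theorem gaussQuadratic_pos (ha : 0 < a) (hb : 0 < b) (θ : ℝ) :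
    0 < a ^ 2 * Real.cos θ ^ 2 + b ^ 2 * Real.sin θ ^ 2 := by
  by_cases h : Real.sin θ = 0
  · have := Real.sin_sq_add_cos_sq θ
    rw [h] at this ⊢
    have hc : Real.cos θ ^ 2 = 1 := by linarith
    rw [hc]; positivity
  · have : 0 < b ^ 2 * Real.sin θ ^ 2 := by positivity
    positivity

theorem continuous_gaussIntegrand (ha : 0 < a) (hb : 0 < b) :
    Continuous fun θ : ℝ => 1 / √(a ^ 2 * Real.cos θ ^ 2 + b ^ 2 * Real.sin θ ^ 2) :=
  continuous_const.div (by fun_prop) fun θ => (Real.sqrt_pos.2 (gaussQuadratic_pos ha hb θ)).ne'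

theorem gaussIntegral_le (hb : 0 < b) (hba : b ≤ a) : gaussIntegral a b ≤ Real.pi / 2 / b := by
  have h := intervalIntegral.integral_mono_on (μ := MeasureTheory.volume)
    (a := 0) (b := Real.pi / 2)
    (g := fun _ => 1 / b) (by positivity)
    ((continuous_gaussIntegrand (hb.trans_le hba) hb).intervalIntegrable _ _)
    intervalIntegrable_const fun θ _ => ?_
  · calc gaussIntegral a b ≤ _ := h
      _ = _ := by simp [div_eq_mul_inv]
  · refine one_div_le_one_div_of_le hb (Real.le_sqrt_of_sq_le ?_)
    have h1 := Real.sin_sq_add_cos_sq θ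
    have h2 : b ^ 2 ≤ a ^ 2 := pow_le_pow_left₀ hb.le hba 2
    nlinarith [sq_nonneg (Real.cos θ)]

theorem le_gaussIntegral (hb : 0 < b) (hba : b ≤ a) : Real.pi / 2 / a ≤ gaussIntegral a b := by
  have ha := hb.trans_le hba
  have h := intervalIntegral.integral_mono_on (μ := MeasureTheory.volume)
    (a := 0) (b := Real.pi / 2)
    (f := fun _ => 1 / a) (by positivity) intervalIntegrable_const
    ((continuous_gaussIntegrand ha hb).intervalIntegrable _ _) fun θ _ => ?_
  · calc Real.pi / 2 / a = _ := by simp [div_eq_mul_inv]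
      _ ≤ _ := h
  · refine one_div_le_one_div_of_le (Real.sqrt_pos.2 (gaussQuadratic_pos ha hb θ))
      ((Real.sqrt_le_left ha.le).2 ?_)
    have h1 := Real.sin_sq_add_cos_sq θ
    have h2 : b ^ 2 ≤ a ^ 2 := pow_le_pow_left₀ hb.le hba 2
    nlinarith [sq_nonneg (Real.sin θ)]

/-- The integrand has period `π` and is even, so the integral over `[0, π]` is twice the one over
`[0, π / 2]`. -/
theorem integral_zero_pi_gaussIntegrand (ha : 0 < a) (hb : 0 < b) :
    ∫ θ in (0 : ℝ)..Real.pi, 1 / √(a ^ 2 * Real.cos θ ^ 2 + b ^ 2 * Real.sin θ ^ 2) =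
      2 * gaussIntegral a b := by
  have hc := continuous_gaussIntegrand ha hb
  rw [← intervalIntegral.integral_add_adjacent_intervals (hc.intervalIntegrable 0 (Real.pi / 2))
    (hc.intervalIntegrable (Real.pi / 2) Real.pi), two_mul]
  congr 1
  have h := intervalIntegral.integral_comp_sub_left (a := Real.pi / 2) (b := Real.pi)
    (fun θ => 1 / √(a ^ 2 * Real.cos θ ^ 2 + b ^ 2 * Real.sin θ ^ 2)) Real.pi
  simp only [Real.cos_pi_sub, Real.sin_pi_sub, neg_sq, sub_self] at h
  rw [h, gaussIntegral]
  congr 1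
  ring

/-- Gauss's transformation. The substitution `φ = θ + arctan ((b / a) tan θ)` maps `[0, π / 2]`
onto `[0, π]`; it is written below as `2 θ - arctan y` with `y` smooth on the whole line. -/
theorem gaussIntegral_agm (ha : 0 < a) (hb : 0 < b) :
    gaussIntegral ((a + b) / 2) (√(a * b)) = gaussIntegral a b := by
  set P : ℝ → ℝ := fun θ => a * Real.cos θ ^ 2 + b * Real.sin θ ^ 2 with hP
  set M : ℝ → ℝ := fun θ => (a - b) * (Real.sin θ * Real.cos θ) with hM
  set Q : ℝ → ℝ := fun θ => a ^ 2 * Real.cos θ ^ 2 + b ^ 2 * Real.sin θ ^ 2 with hQ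
  set f : ℝ → ℝ := fun θ => 2 * θ - Real.arctan (M θ / P θ) with hf
  have hQpos : ∀ θ, 0 < Q θ := gaussQuadratic_pos ha hb
  have hPpos : ∀ θ, 0 < P θ := fun θ => by
    have := gaussQuadratic_pos (Real.sqrt_pos.2 ha) (Real.sqrt_pos.2 hb) θ
    rwa [Real.sq_sqrt ha.le, Real.sq_sqrt hb.le] at this
  have hMPQ : ∀ θ, P θ ^ 2 + M θ ^ 2 = Q θ := fun θ => by
    have h := Real.sin_sq_add_cos_sq θ
    simp only [hP, hM, hQ]
    linear_combination (a ^ 2 * Real.cos θ ^ 2 + b ^ 2 * Real.sin θ ^ 2) * h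
  have hderiv : ∀ θ, HasDerivAt f (1 + a * b / Q θ) θ := fun θ => by
    have hs := Real.hasDerivAt_sin θ
    have hc := Real.hasDerivAt_cos θ
    have hM' : HasDerivAt M ((a - b) * (Real.cos θ * Real.cos θ + Real.sin θ * -Real.sin θ)) θ :=
      (hs.mul hc).const_mul _
    have hP' : HasDerivAt P (a * (2 * Real.cos θ * -Real.sin θ) +
        b * (2 * Real.sin θ * Real.cos θ)) θ := by
      refine (((hc.pow 2).const_mul a).add ((hs.pow 2).const_mul b)).congr_deriv ?_
      norm_num
    refine (((hasDerivAt_id θ).const_mul 2).sub (hM'.div hP' (hPpos θ).ne').arctan).congr_deriv ?_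
    have h1 : 1 + (M θ / P θ) ^ 2 = Q θ / P θ ^ 2 := by
      rw [← hMPQ]; field_simp [(hPpos θ).ne']
    have h := Real.sin_sq_add_cos_sq θ
    have hPne := (hPpos θ).ne'
    have hQne := (hQpos θ).ne'
    rw [Pi.div_apply, h1]
    field_simp
    simp only [hP, hM, hQ]
    have hc2 : Real.cos θ ^ 2 = 1 - Real.sin θ ^ 2 := by linarith
    have hc4 : Real.cos θ ^ 4 = (1 - Real.sin θ ^ 2) ^ 2 := by rw [← hc2]; ring
    ring_nf
    rw [hc4, hc2]
    ring
  -- the cosine of the new angle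
  have hcos : ∀ θ, Real.cos (f θ) = (a * Real.cos θ ^ 2 - b * Real.sin θ ^ 2) / √(Q θ) := by
    intro θ
    have hsq : √(1 + (M θ / P θ) ^ 2) = √(Q θ) / P θ := by
      rw [← hMPQ, div_pow, ← Real.sqrt_sq (hPpos θ).le, ← Real.sqrt_div (by positivity),
        Real.sqrt_sq (hPpos θ).le]
      congr 1
      field_simp [(hPpos θ).ne']
    have hPne := (hPpos θ).ne'
    have hQne := (Real.sqrt_pos.2 (hQpos θ)).ne'
    simp only [hf]
    rw [Real.cos_sub, Real.cos_arctan, Real.sin_arctan, hsq, Real.cos_two_mul, Real.sin_two_mul]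
    field_simp
    simp only [hP, hM]
    have h := Real.sin_sq_add_cos_sq θ
    have hc2 : Real.cos θ ^ 2 = 1 - Real.sin θ ^ 2 := by linarith
    ring_nf
    have hc4 : Real.cos θ ^ 4 = (1 - Real.sin θ ^ 2) ^ 2 := by rw [← hc2]; ring
    rw [hc4, hc2]
    ring
  have hab : 0 < √(a * b) := Real.sqrt_pos.2 (mul_pos ha hb)
  have ham : 0 < (a + b) / 2 := by positivity
  have hnew : ∀ θ, √(((a + b) / 2) ^ 2 * Real.cos (f θ) ^ 2 +
      √(a * b) ^ 2 * Real.sin (f θ) ^ 2) = (Q θ + a * b) / (2 * √(Q θ)) := by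
    intro θ
    have hQne := (hQpos θ).ne'
    have hS := Real.sqrt_pos.2 (hQpos θ)
    refine (Real.sqrt_eq_iff_mul_self_eq_of_pos (by have := hQpos θ; positivity)).2 ?_
    rw [← sq, Real.sin_sq, hcos, Real.sq_sqrt (mul_pos ha hb).le, div_pow, div_pow, mul_pow,
      Real.sq_sqrt (hQpos θ).le]
    field_simp
    rw [Real.sq_sqrt (hQpos θ).le]
    simp only [hQ]
    have h := Real.sin_sq_add_cos_sq θ
    have hc2 : Real.cos θ ^ 2 = 1 - Real.sin θ ^ 2 := by linarith
    rw [hc2]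
    ring
  have hsub := intervalIntegral.integral_comp_mul_deriv (a := 0) (b := Real.pi / 2)
    (fun θ _ => hderiv θ)
    (by
      have : Continuous fun θ => 1 + a * b / Q θ :=
        continuous_const.add (continuous_const.div (by fun_prop) fun θ => (hQpos θ).ne')
      exact this.continuousOn)
    (continuous_gaussIntegrand ham hab)
  have hf0 : f 0 = 0 := by simp [hf, hM]
  have hf1 : f (Real.pi / 2) = Real.pi := by simp [hf, hM]; ring
  rw [hf0, hf1, integral_zero_pi_gaussIntegrand ham hab] at hsub
  have : ∫ θ in (0 : ℝ)..(Real.pi / 2), ((fun θ => 1 / √(((a + b) / 2) ^ 2 * Real.cos θ ^ 2 +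
      √(a * b) ^ 2 * Real.sin θ ^ 2)) ∘ f) θ * (1 + a * b / Q θ) = 2 * gaussIntegral a b := by
    rw [gaussIntegral, ← intervalIntegral.integral_const_mul]
    congr 1
    ext θ
    have hS := Real.sqrt_pos.2 (hQpos θ)
    have hQp := hQpos θ
    have habp := mul_pos ha hb
    simp only [Function.comp, hnew]
    change _ = 2 * (1 / √(Q θ))
    have hSS : √(Q θ) ^ 2 = Q θ := Real.sq_sqrt hQp.le
    field_simp
    rw [hSS]
  linarith

theorem ellipticIntegralK_eq_gaussIntegral {k : ℝ} (ha : 0 < a) (hk : k ^ 2 = 1 - b ^ 2 / a ^ 2) :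
    ellipticIntegralK k = a * gaussIntegral a b := by
  rw [ellipticIntegralK, ellipticIntegralF, gaussIntegral, ← intervalIntegral.integral_const_mul]
  congr 1
  ext θ
  have h : a ^ 2 * Real.cos θ ^ 2 + b ^ 2 * Real.sin θ ^ 2 =
      a ^ 2 * (1 - k ^ 2 * Real.sin θ ^ 2) := by
    rw [hk, Real.cos_sq']; field_simp; ring
  rw [h, Real.sqrt_mul (sq_nonneg a), Real.sqrt_sq ha.le, one_div, one_div, mul_inv,
    mul_inv_cancel_left₀ ha.ne']

end Gauss

/-! ### Bilateral sums of hyperbolic secants -/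

section Sech

open Filter Topology

theorem one_div_cosh_le (y : ℝ) : 1 / Real.cosh y ≤ 2 * Real.exp (-|y|) := by
  rw [← Real.cosh_abs, div_le_iff₀ (Real.cosh_pos _), Real.cosh_eq]
  have h : Real.exp (-|y|) * Real.exp |y| = 1 := by rw [← Real.exp_add]; simp
  nlinarith [sq_nonneg (Real.exp (-|y|))]

theorem hasDerivAt_one_div_cosh (u : ℝ) :
    HasDerivAt (fun u => 1 / Real.cosh u) (-(Real.tanh u * (1 / Real.cosh u))) u := by
  have h := (Real.hasDerivAt_cosh u).inv (Real.cosh_pos u).ne'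
  have := (Real.cosh_pos u).ne'
  simp only [one_div]
  refine h.congr_deriv ?_
  rw [Real.tanh_eq_sinh_div_cosh]
  field_simp

theorem hasDerivAt_tanh_mul_one_div_cosh (u : ℝ) :
    HasDerivAt (fun u => Real.tanh u * (1 / Real.cosh u))
      (2 * (1 / Real.cosh u) ^ 3 - 1 / Real.cosh u) u := by
  have hne := (Real.cosh_pos u).ne'
  have h := ((Real.hasDerivAt_sinh u).div (Real.hasDerivAt_cosh u) hne).mul
    (hasDerivAt_one_div_cosh u)
  have h2 := Real.cosh_sq u
  refine (h.congr_deriv ?_).congr_of_eventuallyEq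
    (Eventually.of_forall fun v => by simp [Real.tanh_eq_sinh_div_cosh])
  simp only [Pi.div_apply]
  rw [Real.tanh_eq_sinh_div_cosh]
  field_simp
  linear_combination 2 * h2

theorem tendsto_tanh_atTop : Tendsto Real.tanh atTop (𝓝 1) := by
  have h : Tendsto (fun u : ℝ => Real.exp (-(2 * u))) atTop (𝓝 0) :=
    Real.tendsto_exp_neg_atTop_nhds_zero.comp (tendsto_id.const_mul_atTop two_pos)
  have h2 : Tendsto (fun u : ℝ => (1 - Real.exp (-(2 * u))) / (1 + Real.exp (-(2 * u))))
      atTop (𝓝 ((1 - 0) / (1 + 0))) :=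
    (h.const_sub 1).div (h.const_add 1) (by norm_num)
  rw [sub_zero, add_zero, div_one] at h2
  refine h2.congr fun u => ?_
  have hu : Real.exp (-u) = Real.exp u * Real.exp (-(2 * u)) := by rw [← Real.exp_add]; ring_nf
  rw [Real.tanh_eq, hu]
  have := Real.exp_pos u
  have := Real.exp_pos (-(2 * u))
  field_simp

theorem tendsto_tanh_atBot : Tendsto Real.tanh atBot (𝓝 (-1)) := by
  have h := (tendsto_tanh_atTop.comp tendsto_neg_atBot_atTop).neg
  refine h.congr fun u => ?_
  simp

/-- The addition formula behind the summation of products of two secants. -/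
theorem sech_mul_sech {u v : ℝ} :
    Real.sinh (u - v) * (1 / Real.cosh u * (1 / Real.cosh v)) = Real.tanh u - Real.tanh v := by
  have hu := (Real.cosh_pos u).ne'
  have hv := (Real.cosh_pos v).ne'
  rw [Real.sinh_sub, Real.tanh_eq_sinh_div_cosh, Real.tanh_eq_sinh_div_cosh]
  field_simp

/-- The addition formula behind the summation of `sech u * sech v ^ 2`. -/
theorem sech_mul_sech_sq {u v : ℝ} :
    Real.sinh (u - v) ^ 2 * (1 / Real.cosh u * (1 / Real.cosh v) ^ 2) =
      Real.cosh (u - v) * (1 / Real.cosh v) - 1 / Real.cosh u -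
        Real.sinh (u - v) * (Real.tanh v * (1 / Real.cosh v)) := by
  have hu := (Real.cosh_pos u).ne'
  have hv := (Real.cosh_pos v).ne'
  have h2 := Real.cosh_sq v
  have h3 := Real.cosh_sq u
  rw [Real.sinh_sub, Real.cosh_sub, Real.tanh_eq_sinh_div_cosh]
  field_simp
  ring_nf
  have e1 : Real.cosh u ^ 2 = Real.sinh u ^ 2 + 1 := h3
  have e2 : Real.cosh v ^ 2 = Real.sinh v ^ 2 + 1 := h2
  rw [e1, e2]
  ring

theorem tsum_int_sub_of_tendsto {f : ℤ → ℝ} {l l' : ℝ} (hs : Summable fun n => f (n + 1) - f n)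
    (ht : Tendsto f atTop (𝓝 l)) (hb : Tendsto f atBot (𝓝 l')) :
    ∑' n, (f (n + 1) - f n) = l - l' := by
  have h1 := hs.hasSum.comp (Finset.tendsto_Ico_neg (R := ℤ))
  have hsum : ∀ N : ℕ, ∑ n ∈ Finset.Ico (-(N : ℤ)) N, (f (n + 1) - f n) = f N - f (-N) := by
    intro N
    induction N with
    | zero => simp
    | succ N ih =>
      have h : Finset.Ico (-((N + 1 : ℕ) : ℤ)) ((N + 1 : ℕ) : ℤ) =
          insert (-(N : ℤ) - 1) (insert (N : ℤ) (Finset.Ico (-(N : ℤ)) N)) := by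
        ext n; simp; omega
      rw [h, Finset.sum_insert (by simp), Finset.sum_insert (by simp), ih]
      push_cast
      rw [sub_add_cancel, show -((N : ℤ) + 1) = -(N : ℤ) - 1 by ring]
      ring
  refine tendsto_nhds_unique h1 ?_
  have h2 : Tendsto (fun N : ℕ => f N - f (-N)) atTop (𝓝 (l - l')) :=
    (ht.comp tendsto_natCast_atTop_atTop).sub
      (hb.comp (tendsto_neg_atTop_atBot.comp tendsto_natCast_atTop_atTop))
  exact h2.congr fun N => (hsum N).symm

/-- Replacing the step `1` of a telescoping series by `d` multiplies its sum by `d`. -/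
theorem hasSum_int_shift_sub {f : ℤ → ℝ} {l : ℝ} (h : HasSum (fun n => f (n + 1) - f n) l)
    (d : ℤ) : HasSum (fun n => f (n + d) - f n) (d * l) := by
  induction d using Int.induction_on with
  | zero => simp
  | succ i ih =>
    convert! ((Equiv.addRight (1 : ℤ)).hasSum_iff.2 ih).add h using 1
    · funext n
      simp only [Function.comp, Equiv.coe_addRight]
      ring_nf
    · push_cast; ring
  | pred i ih =>
    convert! (Equiv.subRight (1 : ℤ)).hasSum_iff.2 (ih.sub h) using 1
    · funext n
      simp only [Function.comp, Equiv.subRight_apply]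
      ring_nf
    · push_cast; ring

end Sech

section LatticeSum

open Filter Topology

/-- The term `sech (x (n + α))`. -/
noncomputable def sechTerm (x α : ℝ) (n : ℤ) : ℝ := 1 / Real.cosh (x * (n + α))

/-- The bilateral sum `∑_n εⁿ sech (x (n + α))`, used for `ε = 1` and `ε = -1`. -/
noncomputable def sechSum (ε x α : ℝ) : ℝ := ∑' n : ℤ, ε ^ n * sechTerm x α n

variable {ε x : ℝ}

theorem sechTerm_pos (x α : ℝ) (n : ℤ) : 0 < sechTerm x α n :=
  one_div_pos.2 (Real.cosh_pos _)

theorem sechTerm_le_one (x α : ℝ) (n : ℤ) : sechTerm x α n ≤ 1 :=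
  (div_le_one (Real.cosh_pos _)).2 (Real.one_le_cosh _)

theorem summable_exp_neg_mul_abs (hx : 0 < x) :
    Summable fun n : ℤ => Real.exp (-(x * |(n : ℝ)|)) := by
  have h : Summable fun n : ℕ => Real.exp (-x) ^ n :=
    summable_geometric_of_lt_one (Real.exp_pos _).le (Real.exp_lt_one_iff.2 (by linarith))
  have h' : Summable fun n : ℕ => Real.exp (-(x * (n : ℝ))) := by
    refine h.congr fun n => ?_
    rw [← Real.exp_nat_mul]; ring_nf
  refine Summable.of_nat_of_neg ?_ ?_ <;> simpa using h'

theorem sechTerm_le (hx : 0 < x) {R α : ℝ} (hα : |α| ≤ R) (n : ℤ) :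
    sechTerm x α n ≤ 2 * Real.exp (x * R) * Real.exp (-(x * |(n : ℝ)|)) := by
  refine (one_div_cosh_le _).trans ?_
  rw [mul_assoc, ← Real.exp_add]
  refine mul_le_mul_of_nonneg_left (Real.exp_le_exp.2 ?_) two_pos.le
  rw [abs_mul, abs_of_pos hx]
  have h : |(n : ℝ)| - |α| ≤ |(n : ℝ) + α| := by
    have := abs_sub_abs_le_abs_sub (n : ℝ) (-α)
    simpa using this
  nlinarith

theorem summable_sechTerm (hx : 0 < x) (α : ℝ) : Summable (sechTerm x α) :=
  ((summable_exp_neg_mul_abs hx).mul_left _).of_nonneg_of_le (fun n => (sechTerm_pos x α n).le)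
    fun n => sechTerm_le hx le_rfl n

theorem abs_zpow_of_sq_eq_one (hε : ε ^ 2 = 1) (n : ℤ) : |ε ^ n| = 1 := by
  have : |ε| = 1 := by rcases sq_eq_one_iff.1 hε with h | h <;> simp [h]
  rw [abs_zpow, this, one_zpow]

theorem summable_zpow_mul {f : ℤ → ℝ} (hf : Summable f) (hε : ε ^ 2 = 1) :
    Summable fun n : ℤ => ε ^ n * f n := by
  refine Summable.of_norm ?_
  simpa only [norm_mul, Real.norm_eq_abs, abs_zpow_of_sq_eq_one hε, one_mul] using hf.abs

theorem summable_sechTerm_pow (hx : 0 < x) (α : ℝ) {m : ℕ} (hm : m ≠ 0) :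
    Summable fun n => sechTerm x α n ^ m :=
  (summable_sechTerm hx α).of_nonneg_of_le (fun n => (pow_pos (sechTerm_pos x α n) m).le)
    fun n => pow_le_of_le_one (sechTerm_pos x α n).le (sechTerm_le_one x α n) hm

theorem summable_tanh_mul_sechTerm (hx : 0 < x) (α : ℝ) :
    Summable fun n : ℤ => Real.tanh (x * (n + α)) * sechTerm x α n := by
  refine (summable_sechTerm hx α).of_norm_bounded fun n => ?_
  rw [norm_mul, Real.norm_eq_abs, Real.norm_eq_abs, abs_of_pos (sechTerm_pos x α n)]
  exact mul_le_of_le_one_left (sechTerm_pos x α n).le (Real.abs_tanh_lt_one _).le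

theorem sechSum_one (x α : ℝ) : sechSum 1 x α = ∑' n, sechTerm x α n := by simp [sechSum]

/-- A product of two absolutely convergent bilateral series, summed along the diagonals. -/
theorem hasSum_diagonals {u v : ℤ → ℝ} (hu : Summable u) (hv : Summable v) :
    HasSum (fun d : ℤ => ∑' b : ℤ, u (b + d) * v b) ((∑' n, u n) * ∑' n, v n) := by
  let e : ℤ × ℤ ≃ ℤ × ℤ :=
    { toFun := fun p => (p.2 + p.1, p.2)
      invFun := fun p => (p.1 - p.2, p.2)
      left_inv := fun p => by simp
      right_inv := fun p => by simp }
  have hs := summable_mul_of_summable_norm hu.norm hv.norm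
  have h1 : HasSum (fun z : ℤ × ℤ => u z.1 * v z.2) ((∑' n, u n) * ∑' n, v n) := by
    rw [tsum_mul_tsum_of_summable_norm hu.norm hv.norm]
    exact hs.hasSum
  have h2 := e.hasSum_iff.2 h1
  exact h2.prod_fiberwise fun d => (h2.summable.prod_factor d).hasSum

theorem sinh_mul_int_ne_zero (hx : 0 < x) {d : ℤ} (hd : d ≠ 0) : Real.sinh (x * d) ≠ 0 := by
  rw [Ne, Real.sinh_eq_zero]
  have : (d : ℝ) ≠ 0 := by exact_mod_cast hd
  positivity

theorem sinh_mul_sechTerm_mul_sechTerm (x α : ℝ) (n d : ℤ) :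
    Real.sinh (x * d) * (sechTerm x α (n + d) * sechTerm x α n) =
      Real.tanh (x * ((n + d : ℤ) + α)) - Real.tanh (x * (n + α)) := by
  rw [← sech_mul_sech, sechTerm, sechTerm,
    show x * (((n + d : ℤ) : ℝ) + α) - x * (n + α) = x * d by push_cast; ring]

theorem tendsto_tanh_lattice_atTop (hx : 0 < x) (α : ℝ) :
    Tendsto (fun n : ℤ => Real.tanh (x * (n + α))) atTop (𝓝 1) :=
  tendsto_tanh_atTop.comp (((tendsto_atTop_add_const_right _ α tendsto_id).const_mul_atTop hx).comp
    tendsto_intCast_atTop_atTop)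

theorem tendsto_tanh_lattice_atBot (hx : 0 < x) (α : ℝ) :
    Tendsto (fun n : ℤ => Real.tanh (x * (n + α))) atBot (𝓝 (-1)) :=
  tendsto_tanh_atBot.comp (((tendsto_atBot_add_const_right _ α tendsto_id).const_mul_atBot hx).comp
    (tendsto_intCast_atBot_iff.2 tendsto_id))

theorem summable_tanh_succ_sub (hx : 0 < x) (α : ℝ) : Summable fun n : ℤ =>
    Real.tanh (x * ((n + 1 : ℤ) + α)) - Real.tanh (x * (n + α)) := by
  have h1 : Summable fun n : ℤ => sechTerm x α (n + 1) * sechTerm x α n := by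
    refine (summable_sechTerm hx α).of_nonneg_of_le
      (fun n => (mul_pos (sechTerm_pos _ _ _) (sechTerm_pos _ _ _)).le) fun n => ?_
    exact mul_le_of_le_one_left (sechTerm_pos x α n).le (sechTerm_le_one x α _)
  refine (h1.mul_left (Real.sinh (x * (1 : ℤ)))).congr fun n => ?_
  exact sinh_mul_sechTerm_mul_sechTerm x α n 1

theorem hasSum_tanh_shift (hx : 0 < x) (α : ℝ) (d : ℤ) :
    HasSum (fun n : ℤ => Real.tanh (x * ((n + d : ℤ) + α)) - Real.tanh (x * (n + α))) (d * 2) := by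
  let f : ℤ → ℝ := fun n => Real.tanh (x * (n + α))
  have hs : Summable fun n => f (n + 1) - f n := summable_tanh_succ_sub hx α
  have ht : ∑' n, (f (n + 1) - f n) = 1 - -1 := tsum_int_sub_of_tendsto hs
    (tendsto_tanh_lattice_atTop hx α) (tendsto_tanh_lattice_atBot hx α)
  have h : HasSum (fun n => f (n + 1) - f n) 2 := by
    rw [show (2 : ℝ) = 1 - -1 by norm_num, ← ht]
    exact hs.hasSum
  exact hasSum_int_shift_sub h d

/-- `∑_n sech (x (n + d + α)) sech (x (n + α)) = 2 d / sinh (x d)` does not depend on `α`. -/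
theorem tsum_sechTerm_mul_shift (hx : 0 < x) (α : ℝ) {d : ℤ} (hd : d ≠ 0) :
    ∑' n : ℤ, sechTerm x α (n + d) * sechTerm x α n = 2 * d / Real.sinh (x * d) := by
  have h0 := sinh_mul_int_ne_zero hx hd
  rw [eq_div_iff h0, mul_comm, ← tsum_mul_left, mul_comm 2, ← (hasSum_tanh_shift hx α d).tsum_eq]
  exact tsum_congr fun n => sinh_mul_sechTerm_mul_sechTerm x α n d

/-- The difference between the square of a secant sum and the sum of the squared secants: the
contribution of the off-diagonal terms `d ≠ 0`, the diagonal `d = 0` being the sum of squares. -/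
noncomputable def sechSqConst (ε x : ℝ) : ℝ :=
  ∑' d : ℤ, if d = 0 then 0 else ε ^ d * (2 * d / Real.sinh (x * d))

/-- The square of a secant sum differs from the sum of the squared secants by a quantity that does
not depend on `α`. -/
theorem sechSum_sq (hx : 0 < x) (hε : ε ^ 2 = 1) (α : ℝ) :
    sechSum ε x α ^ 2 = ∑' n, sechTerm x α n ^ 2 + sechSqConst ε x := by
  have hsum := summable_zpow_mul (summable_sechTerm hx α) hε
  have hε0 : ε ≠ 0 := by rintro rfl; norm_num at hε
  have hsq (b : ℤ) : ε ^ b * ε ^ b = 1 := by rw [← mul_zpow, ← sq, hε, one_zpow]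
  have h := hasSum_diagonals hsum hsum
  rw [sq, sechSum, ← h.tsum_eq, h.summable.tsum_eq_add_tsum_ite 0]
  congr 1
  · refine tsum_congr fun b => ?_
    rw [add_zero]
    linear_combination (sechTerm x α b ^ 2) * hsq b
  · refine tsum_congr fun d => ?_
    split_ifs with hd
    · rfl
    · rw [← tsum_sechTerm_mul_shift hx α hd, ← tsum_mul_left]
      refine tsum_congr fun b => ?_
      rw [zpow_add₀ hε0]
      linear_combination (ε ^ d * (sechTerm x α (b + d) * sechTerm x α b)) * hsq b

theorem sinh_sq_mul_tsum_sechTerm_mul_sq (hx : 0 < x) (α : ℝ) (d : ℤ) :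
    Real.sinh (x * d) ^ 2 * ∑' b : ℤ, sechTerm x α (b + d) * sechTerm x α b ^ 2 =
      (Real.cosh (x * d) - 1) * sechSum 1 x α -
        Real.sinh (x * d) * ∑' n : ℤ, Real.tanh (x * (n + α)) * sechTerm x α n := by
  have hs := summable_sechTerm hx α
  have hs' : Summable fun n => sechTerm x α (n + d) :=
    ((Equiv.addRight d).summable_iff (f := sechTerm x α)).2 hs
  have hS' : ∑' n, sechTerm x α (n + d) = sechSum 1 x α := by
    rw [sechSum_one]; exact (Equiv.addRight d).tsum_eq (sechTerm x α)
  have hterm (b : ℤ) : Real.sinh (x * d) ^ 2 * (sechTerm x α (b + d) * sechTerm x α b ^ 2) =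
      Real.cosh (x * d) * sechTerm x α b - sechTerm x α (b + d) -
        Real.sinh (x * d) * (Real.tanh (x * (b + α)) * sechTerm x α b) := by
    have h := sech_mul_sech_sq (u := x * ((b + d : ℤ) + α)) (v := x * (b + α))
    rwa [show x * (((b + d : ℤ) : ℝ) + α) - x * (b + α) = x * d by push_cast; ring] at h
  rw [← tsum_mul_left, tsum_congr hterm,
    ((hs.mul_left _).sub hs').tsum_sub ((summable_tanh_mul_sechTerm hx α).mul_left _),
    (hs.mul_left _).tsum_sub hs', hS', tsum_mul_left, tsum_mul_left, ← sechSum_one]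
  ring

theorem tsum_sechTerm_mul_sq_shift (hx : 0 < x) (α : ℝ) {d : ℤ} (hd : d ≠ 0) :
    ∑' b : ℤ, sechTerm x α (b + d) * sechTerm x α b ^ 2 =
      (Real.cosh (x * d) - 1) / Real.sinh (x * d) ^ 2 * sechSum 1 x α -
        (∑' n : ℤ, Real.tanh (x * (n + α)) * sechTerm x α n) / Real.sinh (x * d) := by
  have key := sinh_sq_mul_tsum_sechTerm_mul_sq hx α d
  generalize ∑' b : ℤ, sechTerm x α (b + d) * sechTerm x α b ^ 2 = T at *
  generalize ∑' n : ℤ, Real.tanh (x * (n + α)) * sechTerm x α n = W at *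
  generalize sechSum 1 x α = S at *
  have h0 := sinh_mul_int_ne_zero hx hd
  generalize Real.sinh (x * d) = s at *
  field_simp
  linear_combination key

/-- In a bilateral sum whose terms with `d ≠ 0` are split into an even and an odd part, the odd
parts cancel, even when they are not summable by themselves. -/
theorem tsum_int_eq_of_even_add_odd {D c o : ℤ → ℝ} (hD : Summable D)
    (h : ∀ d ≠ 0, D d = c d + o d) (h0 : c 0 = 0) (hc : ∀ d, c (-d) = c d)
    (ho : ∀ d, o (-d) = -o d) : ∑' d, D d = D 0 + ∑' d, c d := by
  rw [hD.tsum_eq_add_tsum_ite 0]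
  congr 1
  have hs : Summable fun d : ℤ => if d = 0 then 0 else D d := by
    refine (hD.update 0 0).congr fun d => ?_
    simp [Function.update_apply]
  have hneg := (Equiv.neg ℤ).tsum_eq fun d : ℤ => if d = 0 then 0 else D d
  have hadd := hs.tsum_add ((Equiv.neg ℤ).summable_iff.2 hs)
  simp only [Function.comp_def] at hadd
  rw [hneg, ← two_mul] at hadd
  rw [← mul_right_inj' (two_ne_zero (α := ℝ)), ← hadd, ← tsum_mul_left]
  refine tsum_congr fun d => ?_
  by_cases hd : d = 0
  · simp [hd, h0]
  · simp only [Equiv.neg_apply, neg_eq_zero, hd, if_false]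
    rw [h d hd, h (-d) (neg_ne_zero.2 hd), hc, ho]
    ring

/-- The sum of the cubed secants in terms of the sum and the sum of the squares; in the diagonal
sum the contributions of `d` and `-d` containing `tanh` cancel. -/
theorem sechSum_one_mul_tsum_sq (hx : 0 < x) :
    ∃ c : ℝ, ∀ α, sechSum 1 x α * ∑' n, sechTerm x α n ^ 2 =
      ∑' n, sechTerm x α n ^ 3 + c * sechSum 1 x α := by
  refine ⟨∑' d : ℤ, (Real.cosh (x * d) - 1) / Real.sinh (x * d) ^ 2, fun α => ?_⟩
  have h := hasSum_diagonals (summable_sechTerm hx α) (summable_sechTerm_pow hx α two_ne_zero)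
  rw [← sechSum_one] at h
  have h0 : ∑' b : ℤ, sechTerm x α (b + 0) * sechTerm x α b ^ 2 = ∑' n, sechTerm x α n ^ 3 := by
    simp only [add_zero, pow_succ' _ 2]
  rw [← h.tsum_eq, tsum_int_eq_of_even_add_odd
    (c := fun d : ℤ => (Real.cosh (x * d) - 1) / Real.sinh (x * d) ^ 2 * sechSum 1 x α)
    (o := fun d : ℤ => -((∑' n : ℤ, Real.tanh (x * (n + α)) * sechTerm x α n) /
      Real.sinh (x * d))) h.summable
    (fun d hd => (tsum_sechTerm_mul_sq_shift hx α hd).trans (sub_eq_add_neg _ _))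
    (by simp) (fun d => ?_) (fun d => ?_), h0, tsum_mul_right]
  · simp only [Int.cast_neg, mul_neg, Real.cosh_neg, Real.sinh_neg, neg_sq]
  · simp only [Int.cast_neg, mul_neg, Real.sinh_neg, div_neg]

end LatticeSum

/-! ### The differential equation and the doubling of the period -/

section LatticeSumODE

open Filter Topology

variable {ε x : ℝ}

theorem sechSum_add_one (hε : ε ^ 2 = 1) (x α : ℝ) :
    sechSum ε x (α + 1) = ε * sechSum ε x α := by
  have hε0 : ε ≠ 0 := by rintro rfl; norm_num at hε
  rw [sechSum, sechSum, ← (Equiv.addRight (1 : ℤ)).tsum_eq (fun n : ℤ => ε ^ n * sechTerm x α n),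
    ← tsum_mul_left]
  refine tsum_congr fun n => ?_
  have h : sechTerm x (α + 1) n = sechTerm x α (n + 1) := by
    simp only [sechTerm]
    rw [show x * ((n : ℝ) + (α + 1)) = x * (((n + 1 : ℤ) : ℝ) + α) by push_cast; ring]
  rw [Equiv.coe_addRight, h, zpow_add_one₀ hε0]
  linear_combination -(ε ^ n * sechTerm x α (n + 1)) * hε

theorem sechSum_neg (hε : ε ^ 2 = 1) (x α : ℝ) : sechSum ε x (-α) = sechSum ε x α := by
  rw [sechSum, sechSum, ← (Equiv.neg ℤ).tsum_eq (fun n : ℤ => ε ^ n * sechTerm x α n)]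
  refine tsum_congr fun n => ?_
  have h : sechTerm x (-α) n = sechTerm x α (-n) := by
    simp only [sechTerm]
    rw [← Real.cosh_neg, show -(x * ((n : ℝ) + -α)) = x * (((-n : ℤ) : ℝ) + α) by push_cast; ring]
  have h2 : ε⁻¹ = ε := by
    rcases sq_eq_one_iff.1 hε with h | h <;> simp [h]
  rw [Equiv.neg_apply, h, zpow_neg, ← inv_zpow, h2]

theorem sechSum_one_sub (hε : ε ^ 2 = 1) (x α : ℝ) :
    sechSum ε x (1 - α) = ε * sechSum ε x α := by
  rw [sub_eq_neg_add, sechSum_add_one hε, sechSum_neg hε]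

theorem sechSum_neg_one_half (x : ℝ) : sechSum (-1) x (1 / 2) = 0 := by
  have h := sechSum_one_sub (ε := -1) (by norm_num) x (1 / 2)
  norm_num at h
  norm_num
  linarith

theorem sechSum_one_pos (hx : 0 < x) (α : ℝ) : 0 < sechSum 1 x α := by
  rw [sechSum_one]
  exact (summable_sechTerm hx α).tsum_pos (fun n => (sechTerm_pos x α n).le) 0 (sechTerm_pos x α 0)

/-- The analogue of `dn² = k² cn² + (1 - k²)`. Both squares differ from the same sum by constants,
and the alternating sum vanishes at `1 / 2`. -/
theorem sechSum_one_sq (hx : 0 < x) (α : ℝ) :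
    sechSum 1 x α ^ 2 = sechSum (-1) x α ^ 2 + sechSum 1 x (1 / 2) ^ 2 := by
  have h1 (α : ℝ) := sechSum_sq (ε := 1) hx (by norm_num) α
  have h2 (α : ℝ) := sechSum_sq (ε := -1) hx (by norm_num) α
  have h3 := h1 (1 / 2)
  have h4 := h2 (1 / 2)
  rw [sechSum_neg_one_half] at h4
  rw [h1, h2, h3]
  linarith

/-- Termwise differentiation of a lattice sum dominated by secants. -/
theorem hasDerivAt_tsum_lattice (hx : 0 < x) {h h' : ℝ → ℝ} (hd : ∀ u, HasDerivAt h (h' u) u)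
    (hb : ∀ u, |h u| ≤ 1 / Real.cosh u) (hb' : ∀ u, |h' u| ≤ 1 / Real.cosh u) (α : ℝ) :
    HasDerivAt (fun α => ∑' n : ℤ, h (x * (n + α))) (x * ∑' n : ℤ, h' (x * (n + α))) α := by
  rw [← tsum_mul_left]
  refine hasDerivAt_tsum_of_isPreconnected (t := Metric.ball 0 (|α| + 1)) (y₀ := α)
    (g' := fun (n : ℤ) α => x * h' (x * (n + α)))
    (u := fun n : ℤ => x * (2 * Real.exp (x * (|α| + 1)) * Real.exp (-(x * |(n : ℝ)|))))
    (((summable_exp_neg_mul_abs hx).mul_left _).mul_left _) Metric.isOpen_ball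
    (convex_ball _ _).isPreconnected (fun n y _ => ?_) (fun n y hy => ?_)
    (by simp) ?_ (by simp)
  · have h1 : HasDerivAt (fun y : ℝ => x * ((n : ℝ) + y)) x y := by
      simpa using ((hasDerivAt_id y).const_add (n : ℝ)).const_mul x
    simpa [Function.comp_def, mul_comm] using (hd (x * (n + y))).comp y h1
  · rw [norm_mul, Real.norm_eq_abs, Real.norm_eq_abs, abs_of_pos hx]
    refine mul_le_mul_of_nonneg_left ((hb' _).trans (sechTerm_le hx ?_ n)) hx.le
    simpa using (mem_ball_zero_iff.1 hy).le
  · exact (summable_sechTerm hx α).of_norm_bounded fun n => hb _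

/-- The derivative of `α ↦ ∑_n sech (x (n + α))`. -/
noncomputable def sechSumDeriv (x α : ℝ) : ℝ :=
  x * ∑' n : ℤ, -(Real.tanh (x * (n + α)) * (1 / Real.cosh (x * (n + α))))

theorem abs_one_div_cosh_cube_le (u : ℝ) :
    |-(2 * (1 / Real.cosh u) ^ 3 - 1 / Real.cosh u)| ≤ 1 / Real.cosh u := by
  have h0 : 0 < 1 / Real.cosh u := one_div_pos.2 (Real.cosh_pos _)
  have h1 : 1 / Real.cosh u ≤ 1 := (div_le_one (Real.cosh_pos _)).2 (Real.one_le_cosh _)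
  have h2 : (1 / Real.cosh u) ^ 3 ≤ 1 / Real.cosh u := pow_le_of_le_one h0.le h1 (by norm_num)
  have h3 : 0 < (1 / Real.cosh u) ^ 3 := pow_pos h0 3
  rw [abs_le]
  constructor <;> linarith

theorem abs_tanh_mul_one_div_cosh_le (u : ℝ) :
    |-(Real.tanh u * (1 / Real.cosh u))| ≤ 1 / Real.cosh u := by
  have h0 : 0 < 1 / Real.cosh u := one_div_pos.2 (Real.cosh_pos _)
  rw [abs_neg, abs_mul, abs_of_pos h0]
  exact mul_le_of_le_one_left h0.le (Real.abs_tanh_lt_one u).le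

theorem hasDerivAt_sechSum_one (hx : 0 < x) (α : ℝ) :
    HasDerivAt (sechSum 1 x) (sechSumDeriv x α) α := by
  have h := hasDerivAt_tsum_lattice hx hasDerivAt_one_div_cosh
    (fun u => (abs_of_pos (one_div_pos.2 (Real.cosh_pos u))).le) abs_tanh_mul_one_div_cosh_le α
  exact h.congr_of_eventuallyEq (Eventually.of_forall fun β => sechSum_one x β)

theorem hasDerivAt_sechSumDeriv_cubes (hx : 0 < x) (α : ℝ) :
    HasDerivAt (sechSumDeriv x)
      (x ^ 2 * (sechSum 1 x α - 2 * ∑' n, sechTerm x α n ^ 3)) α := by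
  have h := (hasDerivAt_tsum_lattice hx (fun u => (hasDerivAt_tanh_mul_one_div_cosh u).neg)
    abs_tanh_mul_one_div_cosh_le abs_one_div_cosh_cube_le α).const_mul x
  refine h.congr_deriv ?_
  rw [← mul_assoc, ← sq]
  congr 1
  rw [sechSum_one, ← tsum_mul_left,
    ← (summable_sechTerm hx α).tsum_sub ((summable_sechTerm_pow hx α three_ne_zero).mul_left _)]
  refine tsum_congr fun n => ?_
  rw [sechTerm]; ring

theorem sechSumDeriv_zero (hx : 0 < x) : sechSumDeriv x 0 = 0 := by
  have h1 := hasDerivAt_sechSum_one hx 0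
  have h2 := HasDerivAt.comp_const_sub 0 0 (f := sechSum 1 x) (by simpa using h1)
  have h3 := h2.congr_of_eventuallyEq (f₁ := sechSum 1 x) (Eventually.of_forall fun β => by
    simp only [zero_sub, sechSum_neg (one_pow 2)])
  have := h1.unique h3
  linarith

theorem sechSumDeriv_half (hx : 0 < x) : sechSumDeriv x (1 / 2) = 0 := by
  have h1 := hasDerivAt_sechSum_one hx (1 / 2)
  have h2 := HasDerivAt.comp_const_sub 1 (1 / 2) (f := sechSum 1 x)
    (by rwa [show (1 : ℝ) - 1 / 2 = 1 / 2 by norm_num])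
  have h3 := h2.congr_of_eventuallyEq (f₁ := sechSum 1 x) (Eventually.of_forall fun β => by
    simp only [sechSum_one_sub (one_pow 2), one_mul])
  have := h1.unique h3
  linarith

/-- The differential equation of the secant sum, the one satisfied by a rescaled `dn`. The
coefficient of the linear term is found from the first integral, the derivative being zero at `0`
and at `1 / 2`. -/
theorem hasDerivAt_sechSumDeriv (hx : 0 < x) (hg : sechSum (-1) x 0 ≠ 0) (α : ℝ) :
    HasDerivAt (sechSumDeriv x)
      (x ^ 2 * (sechSum 1 x 0 ^ 2 + sechSum 1 x (1 / 2) ^ 2) * sechSum 1 x α -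
        2 * x ^ 2 * sechSum 1 x α ^ 3) α := by
  obtain ⟨c, hc⟩ := sechSum_one_mul_tsum_sq hx
  obtain ⟨β, hβ⟩ : ∃ β, ∀ α, HasDerivAt (sechSumDeriv x)
      (β * sechSum 1 x α - 2 * x ^ 2 * sechSum 1 x α ^ 3) α := by
    refine ⟨x ^ 2 * (1 + 2 * sechSqConst 1 x + 2 * c), fun α => ?_⟩
    refine (hasDerivAt_sechSumDeriv_cubes hx α).congr_deriv ?_
    have h1 := hc α
    have h2 := sechSum_sq (ε := 1) hx (by norm_num) α
    linear_combination (2 * x ^ 2) * h1 + (2 * x ^ 2 * sechSum 1 x α) * h2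
  -- the first integral
  have hE : ∀ α, HasDerivAt (fun α => sechSumDeriv x α ^ 2 + x ^ 2 * sechSum 1 x α ^ 4 -
      β * sechSum 1 x α ^ 2) 0 α := by
    intro α
    have h1 := hasDerivAt_sechSum_one hx α
    refine ((((hβ α).pow 2).add ((h1.pow 4).const_mul (x ^ 2))).sub
      ((h1.pow 2).const_mul β)).congr_deriv ?_
    norm_num
    ring
  have hconst := is_const_of_deriv_eq_zero (fun α => (hE α).differentiableAt)
    (fun α => (hE α).deriv) 0 (1 / 2)
  simp only [sechSumDeriv_zero hx, sechSumDeriv_half hx] at hconst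
  have hsq := sechSum_one_sq hx 0
  have hg2 : sechSum (-1) x 0 ^ 2 ≠ 0 := pow_ne_zero 2 hg
  have hβeq : β = x ^ 2 * (sechSum 1 x 0 ^ 2 + sechSum 1 x (1 / 2) ^ 2) := by
    refine mul_left_cancel₀ hg2 ?_
    linear_combination -hconst + (x ^ 2 * (sechSum 1 x 0 ^ 2 + sechSum 1 x (1 / 2) ^ 2) - β) * hsq
  exact hβeq ▸ hβ α

theorem tsum_int_even_add_odd {f : ℤ → ℝ} (hf : Summable f) :
    ∑' n, f n = ∑' n, f (2 * n) + ∑' n, f (2 * n + 1) := by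
  have h1 : Function.Injective fun n : ℤ => 2 * n := fun a b h => by simpa using h
  have h2 : Function.Injective fun n : ℤ => 2 * n + 1 := fun a b h => by simpa using h
  have hc : IsCompl (Set.range fun n : ℤ => 2 * n) (Set.range fun n : ℤ => 2 * n + 1) := by
    have he : (Set.range fun n : ℤ => 2 * n) = {n | Even n} := by
      ext n; simp [even_iff_two_dvd, dvd_def]
    have ho : (Set.range fun n : ℤ => 2 * n + 1) = {n | Odd n} := by
      ext n; simp [Odd]
    rw [he, ho]
    exact Int.isCompl_even_odd
  have he := (h1.hasSum_range_iff (f := f)).2 (hf.comp_injective h1).hasSum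
  have ho := (h2.hasSum_range_iff (f := f)).2 (hf.comp_injective h2).hasSum
  exact (he.add_isCompl hc ho).tsum_eq

/-- Splitting into even and odd `n` expresses the sums for `x` through those for `2 x`. -/
theorem sechSum_even_odd (hx : 0 < x) (hε : ε ^ 2 = 1) :
    sechSum ε x 0 = sechSum 1 (2 * x) 0 + ε * sechSum 1 (2 * x) (1 / 2) := by
  have hε0 : ε ≠ 0 := by rintro rfl; norm_num at hε
  have hev (n : ℤ) : ε ^ (2 * n) = 1 := by
    rw [zpow_mul]; norm_cast; rw [hε, one_zpow]
  rw [sechSum, tsum_int_even_add_odd (summable_zpow_mul (summable_sechTerm hx 0) hε),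
    sechSum_one, sechSum_one, ← tsum_mul_left]
  congr 1
  · refine tsum_congr fun n => ?_
    rw [hev, one_mul, sechTerm, sechTerm]
    rw [show x * (((2 * n : ℤ) : ℝ) + 0) = 2 * x * (n + 0) by push_cast; ring]
  · refine tsum_congr fun n => ?_
    rw [zpow_add_one₀ hε0, hev, one_mul, sechTerm, sechTerm]
    rw [show x * (((2 * n + 1 : ℤ) : ℝ) + 0) = 2 * x * (n + 1 / 2) by push_cast; ring]

theorem sechSum_two_mul (hx : 0 < x) :
    sechSum 1 (2 * x) 0 = (sechSum 1 x 0 + sechSum (-1) x 0) / 2 := by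
  rw [sechSum_even_odd (ε := 1) hx (by norm_num), sechSum_even_odd (ε := -1) hx (by norm_num)]
  ring

/-- The geometric mean half of the arithmetic-geometric mean step; the arithmetic half is
`sechSum_two_mul`. -/
theorem sechSum_neg_one_two_mul_sq (hx : 0 < x) :
    sechSum (-1) (2 * x) 0 ^ 2 = sechSum 1 x 0 * sechSum (-1) x 0 := by
  have h := sechSum_one_sq (mul_pos two_pos hx) 0
  rw [sechSum_even_odd (ε := 1) hx (by norm_num), sechSum_even_odd (ε := -1) hx (by norm_num)]
  linarith

theorem tendsto_sechSum_atTop (hε : ε ^ 2 = 1) :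
    Tendsto (fun x => sechSum ε x 0) atTop (𝓝 1) := by
  have h := tendsto_tsum_of_dominated_convergence (𝓕 := atTop)
    (f := fun (x : ℝ) (n : ℤ) => ε ^ n * sechTerm x 0 n)
    (g := fun n : ℤ => if n = 0 then (1 : ℝ) else 0)
    (bound := fun n : ℤ => 2 * Real.exp (-(1 * |(n : ℝ)|)))
    ((summable_exp_neg_mul_abs one_pos).mul_left 2) (fun n => ?_) ?_
  · simpa [sechSum] using h
  · split_ifs with hn
    · simp [hn, sechTerm]
    · have hn' : (0 : ℝ) < |(n : ℝ)| := abs_pos.2 (by exact_mod_cast hn)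
      have h1 : Tendsto (fun x : ℝ => 2 * Real.exp (-(x * |(n : ℝ)|))) atTop (𝓝 (2 * 0)) :=
        (Real.tendsto_exp_neg_atTop_nhds_zero.comp
          (tendsto_id.atTop_mul_const hn')).const_mul 2
      rw [mul_zero] at h1
      refine squeeze_zero_norm' ?_ h1
      filter_upwards [eventually_gt_atTop 0] with x hx
      rw [norm_mul, Real.norm_eq_abs, abs_zpow_of_sq_eq_one hε, one_mul, Real.norm_eq_abs,
        abs_of_pos (sechTerm_pos _ _ _)]
      simpa using sechTerm_le hx (R := 0) (α := 0) (by simp) n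
  · filter_upwards [eventually_ge_atTop 1] with x hx n
    rw [norm_mul, Real.norm_eq_abs, abs_zpow_of_sq_eq_one hε, one_mul, Real.norm_eq_abs,
      abs_of_pos (sechTerm_pos _ _ _)]
    have h1 := sechTerm_le (one_pos.trans_le hx) (R := 0) (α := 0) (by simp) n
    rw [mul_zero, Real.exp_zero, mul_one] at h1
    refine h1.trans (mul_le_mul_of_nonneg_left (Real.exp_le_exp.2 (neg_le_neg ?_)) two_pos.le)
    exact mul_le_mul_of_nonneg_right hx (abs_nonneg _)

end LatticeSumODE

/-! ### The partial fraction expansion and the product formula -/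

section Product

open Filter Topology

theorem qShiftedFactorial_succ (z q : ℝ) (n : ℕ) :
    qShiftedFactorial z q (n + 1) = qShiftedFactorial z q n * (1 - z * q ^ n) :=
  Finset.prod_range_succ _ _

theorem one_sub_mul_pow_pos {z q : ℝ} (hz : z < 1) (hq0 : 0 < q) (hq1 : q < 1) (i : ℕ) :
    0 < 1 - z * q ^ i := by
  have h1 : 0 < q ^ i := pow_pos hq0 i
  have h2 : q ^ i ≤ 1 := pow_le_one₀ hq0.le hq1.le
  rcases le_or_gt z 0 with h | h <;> nlinarith

theorem qShiftedFactorialInf_pos {z q : ℝ} (hz : z < 1) (hq0 : 0 < q) (hq1 : q < 1) :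
    0 < qShiftedFactorialInf z q := by
  have hs : Summable fun i : ℕ => Real.log (1 - z * q ^ i) := by
    simpa only [← sub_eq_add_neg] using Real.summable_log_one_add_of_summable
      ((summable_geometric_of_lt_one hq0.le hq1).mul_left z).neg
  rw [qShiftedFactorialInf,
    ← Real.rexp_tsum_eq_tprod (fun i => one_sub_mul_pow_pos hz hq0 hq1 i) hs]
  exact Real.exp_pos _

/-- The ratio `(ε q; q²)_m / (q²; q²)_m`, in terms of which the residues are expressed. -/
noncomputable def residueRatio (ε q : ℝ) (m : ℕ) : ℝ :=
  qShiftedFactorial (ε * q) (q ^ 2) m / qShiftedFactorial (q ^ 2) (q ^ 2) m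

variable {ε q : ℝ}

theorem residueRatio_zero : residueRatio ε q 0 = 1 := by simp [residueRatio, qShiftedFactorial]

theorem residueRatio_succ (m : ℕ) : residueRatio ε q (m + 1) =
    residueRatio ε q m * ((1 - ε * q * (q ^ 2) ^ m) / (1 - (q ^ 2) ^ (m + 1))) := by
  rw [residueRatio, residueRatio, qShiftedFactorial_succ, qShiftedFactorial_succ, mul_div_mul_comm,
    pow_succ' (q ^ 2) m]

/-- The residue at the last pole, obtained by reversing the order of the factors. -/
theorem last_residue (hq0 : 0 < q) (hε : ε ^ 2 = 1) (M : ℕ) :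
    (1 - ε / q) * (qShiftedFactorial (ε * q / (q ^ 2) ^ (M + 1)) (q ^ 2) M /
      qShiftedFactorial (1 / (q ^ 2) ^ (M + 1)) (q ^ 2) (M + 1)) =
        (ε * q) ^ (M + 1) * residueRatio ε q (M + 1) := by
  have h1 : (1 - ε / q) * qShiftedFactorial (ε * q / (q ^ 2) ^ (M + 1)) (q ^ 2) M =
      qShiftedFactorial (ε * q / (q ^ 2) ^ (M + 1)) (q ^ 2) (M + 1) := by
    rw [qShiftedFactorial_succ, mul_comm]
    congr 2
    field_simp
    ring
  have hc : (ε * q) ^ (M + 1) = ∏ _j ∈ Finset.range (M + 1), ε * q := by simp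
  rw [← mul_div_assoc, h1, residueRatio, qShiftedFactorial, qShiftedFactorial, qShiftedFactorial,
    qShiftedFactorial, ← Finset.prod_div_distrib, ← Finset.prod_div_distrib,
    ← Finset.prod_range_reflect, hc, ← Finset.prod_mul_distrib]
  refine Finset.prod_congr rfl fun j hj => ?_
  obtain ⟨i, rfl⟩ : ∃ i, M = j + i := ⟨M - j, by have := Finset.mem_range.1 hj; omega⟩
  rw [show j + i + 1 - 1 - j = i by omega]
  have hp : q ^ 2 ≠ 0 := by positivity
  have e1 : 1 - ε * q / (q ^ 2) ^ (j + i + 1) * (q ^ 2) ^ i =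
      -(ε / (q * (q ^ 2) ^ j)) * (1 - ε * q * (q ^ 2) ^ j) := by
    have : (q ^ 2) ^ (j + i + 1) = q ^ 2 * (q ^ 2) ^ j * (q ^ 2) ^ i := by ring
    rw [this]
    field_simp
    linear_combination (-(q * (q ^ 2) ^ j)) * hε
  have e2 : 1 - 1 / (q ^ 2) ^ (j + i + 1) * (q ^ 2) ^ i =
      -(1 / (q ^ 2 * (q ^ 2) ^ j)) * (1 - q ^ 2 * (q ^ 2) ^ j) := by
    have : (q ^ 2) ^ (j + i + 1) = q ^ 2 * (q ^ 2) ^ j * (q ^ 2) ^ i := by ring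
    rw [this]
    field_simp
    ring
  rw [e1, e2, mul_div_mul_comm]
  congr 1
  field_simp

/-- A partial fraction expansion with poles at `W = -q ^ (-2 j)`, `0 ≤ j ≤ M`. -/
theorem partialFraction (hq0 : 0 < q) (hq1 : q < 1) (hε : ε ^ 2 = 1) (M : ℕ) {W : ℝ}
    (hW : ∀ j ≤ M, 1 + W * (q ^ 2) ^ j ≠ 0) :
    qShiftedFactorial (-(ε * q * W)) (q ^ 2) M / qShiftedFactorial (-W) (q ^ 2) (M + 1) =
      ∑ j ∈ Finset.range (M + 1), (ε * q) ^ j * residueRatio ε q j * residueRatio ε q (M - j) /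
        (1 + W * (q ^ 2) ^ j) := by
  induction M generalizing W with
  | zero => simp [residueRatio_zero, qShiftedFactorial]
  | succ M ih =>
    have hp0 : 0 < q ^ 2 := by positivity
    have hp1 : q ^ 2 < 1 := pow_lt_one₀ hq0.le hq1 two_ne_zero
    have hz0 : (q ^ 2) ^ (M + 1) ≠ 0 := by positivity
    have hne (j : ℕ) : 1 - (q ^ 2) ^ (j + 1) ≠ 0 :=
      (sub_pos.2 (pow_lt_one₀ hp0.le hp1 j.succ_ne_zero)).ne'
    -- the residue at the new pole is read off from the induction hypothesis at that point
    have hlast := ih (W := -(1 / (q ^ 2) ^ (M + 1))) fun j hj => by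
      obtain ⟨i, rfl⟩ := Nat.exists_eq_add_of_le hj
      have : 1 + -(1 / (q ^ 2) ^ (j + i + 1)) * (q ^ 2) ^ j =
          -(1 - (q ^ 2) ^ (i + 1)) / (q ^ 2) ^ (i + 1) := by
        have e : (q ^ 2) ^ (j + i + 1) = (q ^ 2) ^ j * (q ^ 2) ^ (i + 1) := by ring
        rw [e]
        field_simp
        ring
      rw [this]
      exact div_ne_zero (neg_ne_zero.2 (hne i)) (by positivity)
    rw [neg_neg, show -(ε * q * -(1 / (q ^ 2) ^ (M + 1))) = ε * q / (q ^ 2) ^ (M + 1) by ring]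
      at hlast
    have hres := last_residue hq0 hε M
    rw [hlast] at hres
    rw [qShiftedFactorial_succ, qShiftedFactorial_succ _ _ (M + 1), mul_div_mul_comm,
      ih fun j hj => hW j (hj.trans M.le_succ), Finset.sum_range_succ _ (M + 1), Nat.sub_self,
      residueRatio_zero, mul_one, ← hres, Finset.sum_mul, Finset.mul_sum, Finset.sum_div,
      ← Finset.sum_add_distrib]
    refine Finset.sum_congr rfl fun j hj => ?_
    obtain ⟨i, rfl⟩ : ∃ i, M = j + i := ⟨M - j, by have := Finset.mem_range.1 hj; omega⟩
    rw [show j + i + 1 - j = i + 1 by omega, show j + i - j = i by omega, residueRatio_succ]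
    have h1 := hW j (by omega)
    have h2 := hW (j + i + 1) le_rfl
    have h3 := hne i
    have e1 : (q ^ 2) ^ (j + i + 1) = (q ^ 2) ^ j * (q ^ 2) ^ (i + 1) := by ring
    have e2 : (q ^ 2) ^ (j + i) = (q ^ 2) ^ j * (q ^ 2) ^ i := by ring
    have e3 : (q ^ 2) ^ (i + 1) = q ^ 2 * (q ^ 2) ^ i := by ring
    rw [e1, e3] at h2
    rw [e3] at h3
    rw [e1, e2, e3]
    have hy : (q ^ 2) ^ j ≠ 0 := by positivity
    have ht : (q ^ 2) ^ i ≠ 0 := by positivity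
    generalize (q ^ 2) ^ j = y at *
    generalize (q ^ 2) ^ i = t at *
    have h4 : 1 + -(1 / (y * (q ^ 2 * t))) * y = -(1 - q ^ 2 * t) / (q ^ 2 * t) := by
      field_simp; ring
    have core : 1 / (1 + W * y) * ((1 + ε * q * W * (y * t)) / (1 + W * (y * (q ^ 2 * t)))) =
        (1 - ε * q * t) / (1 - q ^ 2 * t) / (1 + W * y) +
          (1 - ε / q) * (1 / (-(1 - q ^ 2 * t) / (q ^ 2 * t))) / (1 + W * (y * (q ^ 2 * t))) := by
      have hq : q ≠ 0 := hq0.ne'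
      have h2' : 1 + W * y * q ^ 2 * t ≠ 0 := by
        rwa [show W * y * q ^ 2 * t = W * (y * (q ^ 2 * t)) by ring]
      field_simp
      ring
    rw [h4, neg_mul, sub_neg_eq_add, neg_mul, sub_neg_eq_add]
    linear_combination ((ε * q) ^ j * residueRatio ε q j * residueRatio ε q i) * core

end Product

section ProductLimit

open Filter Topology

variable {ε q : ℝ}

theorem qShiftedFactorial_add (z q : ℝ) (m n : ℕ) :
    qShiftedFactorial z q (m + n) =
      qShiftedFactorial z q m * qShiftedFactorial (z * q ^ m) q n := by
  simp only [qShiftedFactorial, Finset.prod_range_add, pow_add, mul_assoc]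

theorem qShiftedFactorial_div_pow {z p : ℝ} (hz : z ≠ 0) (hp : p ≠ 0) (N : ℕ) :
    qShiftedFactorial (z / p ^ N) p N =
      (∏ j ∈ Finset.range N, -z / (p * p ^ j)) * qShiftedFactorial (p / z) p N := by
  rw [qShiftedFactorial, qShiftedFactorial, ← Finset.prod_mul_distrib, ← Finset.prod_range_reflect]
  refine Finset.prod_congr rfl fun j hj => ?_
  obtain ⟨i, rfl⟩ : ∃ i, N = j + 1 + i :=
    ⟨N - (j + 1), by have := Finset.mem_range.1 hj; omega⟩
  rw [show j + 1 + i - 1 - j = i by omega, pow_add, pow_succ]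
  field_simp
  ring

theorem sum_Icc_neg_eq_sum_range (N : ℕ) (g : ℤ → ℝ) :
    ∑ n ∈ Finset.Icc (-(N : ℤ)) N, g n = ∑ j ∈ Finset.range (2 * N + 1), g ((j : ℤ) - N) := by
  refine Finset.sum_nbij' (fun n => (n + N).toNat) (fun j => (j : ℤ) - N) ?_ ?_ ?_ ?_ ?_
  · intro n hn; simp only [Finset.mem_Icc, Finset.mem_range] at *; omega
  · intro n hn; simp only [Finset.mem_Icc, Finset.mem_range] at *; omega
  · intro n hn; simp only [Finset.mem_Icc] at *; omega
  · intro n hn; simp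
  · intro n hn; simp only [Finset.mem_Icc] at hn; congr 1; omega

/-- The partial fraction expansion with `2 N + 1` poles, centred by the substitution
`W = w / q ^ (2 N)`. -/
theorem partialFraction_symmetric (hq0 : 0 < q) (hq1 : q < 1) (hε : ε ^ 2 = 1) (N : ℕ) {w : ℝ}
    (hw : 0 < w) :
    ∑ n ∈ Finset.Icc (-(N : ℤ)) N, (ε * q) ^ n * residueRatio ε q (N + n).toNat *
        residueRatio ε q (N - n).toNat / (1 + w * (q ^ 2) ^ n) =
      1 / (1 + w) * (qShiftedFactorial (-(ε * q * w)) (q ^ 2) N *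
        qShiftedFactorial (-(ε * q / w)) (q ^ 2) N /
          (qShiftedFactorial (-(q ^ 2 * w)) (q ^ 2) N *
            qShiftedFactorial (-(q ^ 2 / w)) (q ^ 2) N)) := by
  have hε0 : ε ≠ 0 := by rintro rfl; norm_num at hε
  have hp0 : 0 < q ^ 2 := by positivity
  have hεq : ε * q ≠ 0 := mul_ne_zero hε0 hq0.ne'
  have key := partialFraction hq0 hq1 hε (2 * N) (W := w / (q ^ 2) ^ N) fun j _ => by positivity
  have e1 : qShiftedFactorial (-(ε * q * (w / (q ^ 2) ^ N))) (q ^ 2) (2 * N) =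
      (∏ j ∈ Finset.range N, ε * q * w / (q ^ 2 * (q ^ 2) ^ j)) *
        qShiftedFactorial (-(ε * q / w)) (q ^ 2) N *
          qShiftedFactorial (-(ε * q * w)) (q ^ 2) N := by
    have hz : -(ε * q * w) ≠ 0 := neg_ne_zero.2 (mul_ne_zero hεq hw.ne')
    rw [two_mul, qShiftedFactorial_add, ← mul_div_assoc, ← neg_div,
      qShiftedFactorial_div_pow hz hp0.ne', neg_neg, div_mul_cancel₀ _ (by positivity),
      show q ^ 2 / -(ε * q * w) = -(ε * q / w) by
        field_simp
        linear_combination hε]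
  have e2 : qShiftedFactorial (-(w / (q ^ 2) ^ N)) (q ^ 2) (2 * N + 1) =
      (∏ j ∈ Finset.range N, w / (q ^ 2 * (q ^ 2) ^ j)) *
        qShiftedFactorial (-(q ^ 2 / w)) (q ^ 2) N *
          ((1 + w) * qShiftedFactorial (-(q ^ 2 * w)) (q ^ 2) N) := by
    have h1 : qShiftedFactorial (-w) (q ^ 2) (N + 1) =
        (1 + w) * qShiftedFactorial (-(q ^ 2 * w)) (q ^ 2) N := by
      rw [add_comm N 1, qShiftedFactorial_add, pow_one, neg_mul, mul_comm w]
      simp [qShiftedFactorial]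
    rw [two_mul, add_assoc, qShiftedFactorial_add, ← neg_div,
      qShiftedFactorial_div_pow (neg_ne_zero.2 hw.ne') hp0.ne', neg_neg,
      div_mul_cancel₀ _ (by positivity), h1, div_neg]
  have e3 : ∏ j ∈ Finset.range N, ε * q * w / (q ^ 2 * (q ^ 2) ^ j) =
      (ε * q) ^ N * ∏ j ∈ Finset.range N, w / (q ^ 2 * (q ^ 2) ^ j) := by
    rw [show (ε * q) ^ N = ∏ _j ∈ Finset.range N, ε * q by simp, ← Finset.prod_mul_distrib]
    exact Finset.prod_congr rfl fun j _ => by ring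
  have e4 : ∏ j ∈ Finset.range N, w / (q ^ 2 * (q ^ 2) ^ j) ≠ 0 :=
    (Finset.prod_pos fun j _ => by positivity).ne'
  have e5 : (ε * q) ^ N ≠ 0 := pow_ne_zero N hεq
  have hs : (ε * q) ^ N * ∑ n ∈ Finset.Icc (-(N : ℤ)) N, (ε * q) ^ n *
      residueRatio ε q (N + n).toNat * residueRatio ε q (N - n).toNat / (1 + w * (q ^ 2) ^ n) =
      ∑ j ∈ Finset.range (2 * N + 1), (ε * q) ^ j * residueRatio ε q j *
        residueRatio ε q (2 * N - j) / (1 + w / (q ^ 2) ^ N * (q ^ 2) ^ j) := by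
    rw [sum_Icc_neg_eq_sum_range, Finset.mul_sum]
    refine Finset.sum_congr rfl fun j hj => ?_
    have hj' := Finset.mem_range.1 hj
    rw [show ((N : ℤ) + ((j : ℤ) - N)).toNat = j by omega,
      show ((N : ℤ) - ((j : ℤ) - N)).toNat = 2 * N - j by omega,
      zpow_sub₀ hεq, zpow_sub₀ hp0.ne', zpow_natCast, zpow_natCast, zpow_natCast, zpow_natCast,
      show w / (q ^ 2) ^ N * (q ^ 2) ^ j = w * ((q ^ 2) ^ j / (q ^ 2) ^ N) by ring]
    generalize 1 + w * ((q ^ 2) ^ j / (q ^ 2) ^ N) = D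
    field_simp
  refine mul_left_cancel₀ e5 ?_
  rw [hs, ← key, e1, e2, e3]
  have hw1 : 1 + w ≠ 0 := by positivity
  field_simp

theorem bilateralTerm_eq_sechTerm (hq0 : 0 < q) (α : ℝ) (n : ℤ) :
    bilateralTerm α q n = sechTerm (-Real.log q) α n / 2 := by
  rw [bilateralTerm, sechTerm, Real.cosh_eq, Real.rpow_def_of_pos hq0, Real.rpow_def_of_pos hq0,
    show Real.log q * (-(n : ℝ) - α) = -Real.log q * (n + α) by ring,
    show Real.log q * ((n : ℝ) + α) = -(-Real.log q * (n + α)) by ring]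
  have := Real.exp_pos (-Real.log q * (n + α))
  have := Real.exp_pos (-(-Real.log q * (n + α)))
  field_simp
  ring

theorem rpow_mul_zpow_div (hq0 : 0 < q) (α : ℝ) (n : ℤ) :
    q ^ α * (q ^ n / (1 + q ^ (2 * α) * (q ^ 2) ^ n)) = bilateralTerm α q n := by
  have h1 : q ^ ((n : ℝ) + α) = q ^ n * q ^ α := by rw [Real.rpow_add hq0, Real.rpow_intCast]
  have h2 : q ^ (-(n : ℝ) - α) = (q ^ n * q ^ α)⁻¹ := by
    rw [← h1, ← Real.rpow_neg hq0.le]; ring_nf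
  have h3 : q ^ (2 * α) = (q ^ α) ^ 2 := by
    rw [mul_comm, Real.rpow_mul hq0.le]; norm_cast
  have h4 : (q ^ 2) ^ n = (q ^ n) ^ 2 := by
    rw [← zpow_natCast, ← zpow_natCast, ← zpow_mul, ← zpow_mul, mul_comm]
  rw [bilateralTerm, h1, h2, h3, h4]
  have ha := Real.rpow_pos_of_pos hq0 α
  have hb := zpow_pos hq0 n
  generalize q ^ α = a at *
  generalize q ^ n = b at *
  field_simp
  ring

theorem tendsto_residueRatio (hq0 : 0 < q) (hq1 : q < 1) (ε : ℝ) :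
    Tendsto (residueRatio ε q) atTop (𝓝 (qShiftedFactorialInf (ε * q) (q ^ 2) /
      qShiftedFactorialInf (q ^ 2) (q ^ 2))) := by
  have hp0 : 0 < q ^ 2 := by positivity
  have hp1 : q ^ 2 < 1 := pow_lt_one₀ hq0.le hq1 two_ne_zero
  have hp : |q ^ 2| < 1 := by rwa [abs_of_pos hp0]
  exact (tendsto_qShiftedFactorial _ hp).div (tendsto_qShiftedFactorial _ hp)
    (qShiftedFactorialInf_pos hp1 hp0 hp1).ne'

/-- The product formula for `∑_n εⁿ / (q ^ (n + α) + q ^ (-n - α))`, a limiting case of the partial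
fraction expansion of a finite product. -/
theorem sechSum_mul_eq_product (hq0 : 0 < q) (hq1 : q < 1) (hε : ε ^ 2 = 1) (α : ℝ) :
    sechSum ε (-Real.log q) α / 2 * (qShiftedFactorialInf (ε * q) (q ^ 2) /
        qShiftedFactorialInf (q ^ 2) (q ^ 2)) ^ 2 =
      1 / (q ^ α + q ^ (-α)) *
        (qShiftedFactorialInf (-(ε * q ^ (1 + 2 * α))) (q ^ 2) *
          qShiftedFactorialInf (-(ε * q ^ (1 - 2 * α))) (q ^ 2) /
        (qShiftedFactorialInf (-q ^ (2 + 2 * α)) (q ^ 2) *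
          qShiftedFactorialInf (-q ^ (2 - 2 * α)) (q ^ 2))) := by
  have hp0 : 0 < q ^ 2 := by positivity
  have hp1 : q ^ 2 < 1 := pow_lt_one₀ hq0.le hq1 two_ne_zero
  have hp : |q ^ 2| < 1 := by rwa [abs_of_pos hp0]
  have hx : 0 < -Real.log q := neg_pos.2 (Real.log_neg hq0 hq1)
  set x := -Real.log q with hxdef
  set w := q ^ (2 * α) with hw
  have hw0 : 0 < w := Real.rpow_pos_of_pos hq0 _
  set U := qShiftedFactorialInf (ε * q) (q ^ 2) / qShiftedFactorialInf (q ^ 2) (q ^ 2) with hU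
  have hu : Tendsto (residueRatio ε q) atTop (𝓝 U) := tendsto_residueRatio hq0 hq1 ε
  obtain ⟨C, hC⟩ : ∃ C, ∀ m, |residueRatio ε q m| ≤ C := by
    obtain ⟨C, hC⟩ := hu.abs.bddAbove_range
    exact ⟨C, fun m => hC ⟨m, rfl⟩⟩
  have hC0 : 0 ≤ C := (abs_nonneg _).trans (hC 0)
  let f : ℕ → ℤ → ℝ := fun N n => if n ∈ Finset.Icc (-(N : ℤ)) N then
    residueRatio ε q (N + n).toNat * residueRatio ε q (N - n).toNat *
      (ε ^ n * (sechTerm x α n / 2)) else 0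
  -- the residues are bounded and converge termwise
  have hlim : Tendsto (fun N => ∑' n, f N n) atTop
      (𝓝 (∑' n : ℤ, U * U * (ε ^ n * (sechTerm x α n / 2)))) := by
    refine tendsto_tsum_of_dominated_convergence (bound := fun n => C * C * (sechTerm x α n / 2))
      (((summable_sechTerm hx α).div_const 2).mul_left _) (fun n => ?_)
      (Eventually.of_forall fun N n => ?_)
    · have h1 : Tendsto (fun N : ℕ => ((N : ℤ) + n).toNat) atTop atTop :=
        tendsto_atTop.2 fun b => by
          filter_upwards [eventually_ge_atTop (b + n.natAbs)] with N hN
          omega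
      have h2 : Tendsto (fun N : ℕ => ((N : ℤ) - n).toNat) atTop atTop :=
        tendsto_atTop.2 fun b => by
          filter_upwards [eventually_ge_atTop (b + n.natAbs)] with N hN
          omega
      refine (((hu.comp h1).mul (hu.comp h2)).mul_const _).congr' ?_
      filter_upwards [eventually_ge_atTop n.natAbs] with N hN
      have : n ∈ Finset.Icc (-(N : ℤ)) N := by simp only [Finset.mem_Icc]; omega
      simp only [f, this, if_true, Function.comp]
    · have hs := sechTerm_pos x α n
      simp only [f]
      split_ifs
      · rw [norm_mul, norm_mul, norm_mul, Real.norm_eq_abs, Real.norm_eq_abs, Real.norm_eq_abs,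
          Real.norm_eq_abs, abs_zpow_of_sq_eq_one hε, one_mul, abs_of_pos (half_pos hs)]
        exact mul_le_mul_of_nonneg_right (mul_le_mul (hC _) (hC _) (abs_nonneg _) hC0)
          (half_pos hs).le
      · rw [norm_zero]; positivity
  have hfin (N : ℕ) : ∑' n, f N n = q ^ α / (1 + w) *
      (qShiftedFactorial (-(ε * q * w)) (q ^ 2) N * qShiftedFactorial (-(ε * q / w)) (q ^ 2) N /
        (qShiftedFactorial (-(q ^ 2 * w)) (q ^ 2) N *
          qShiftedFactorial (-(q ^ 2 / w)) (q ^ 2) N)) := by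
    rw [div_eq_mul_one_div, mul_assoc, ← partialFraction_symmetric hq0 hq1 hε N hw0,
      tsum_eq_sum (s := Finset.Icc (-(N : ℤ)) N) fun n hn => by simp only [f, hn, if_false],
      Finset.mul_sum]
    refine Finset.sum_congr rfl fun n hn => ?_
    simp only [f, hn, if_true]
    rw [← bilateralTerm_eq_sechTerm hq0, ← rpow_mul_zpow_div hq0, mul_zpow]
    ring
  have hpos {z : ℝ} (hz : 0 < z) : qShiftedFactorialInf (-z) (q ^ 2) ≠ 0 :=
    (qShiftedFactorialInf_pos (by linarith) hp0 hp1).ne'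
  have hlim2 := ((((tendsto_qShiftedFactorial (-(ε * q * w)) hp).mul
    (tendsto_qShiftedFactorial (-(ε * q / w)) hp)).div
    ((tendsto_qShiftedFactorial (-(q ^ 2 * w)) hp).mul
    (tendsto_qShiftedFactorial (-(q ^ 2 / w)) hp))
    (mul_ne_zero (hpos (by positivity)) (hpos (by positivity)))).const_mul (q ^ α / (1 + w)))
  have heq := tendsto_nhds_unique hlim (hlim2.congr fun N => (hfin N).symm)
  have h1 : ∑' n : ℤ, U * U * (ε ^ n * (sechTerm x α n / 2)) = sechSum ε x α / 2 * U ^ 2 := by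
    rw [sechSum, tsum_mul_left]
    simp only [← mul_div_assoc]
    rw [tsum_div_const]
    ring
  have e0 : q ^ α / (1 + w) = 1 / (q ^ α + q ^ (-α)) := by
    have ha := Real.rpow_pos_of_pos hq0 α
    rw [hw, mul_comm 2 α, Real.rpow_mul hq0.le, Real.rpow_neg hq0.le]
    norm_cast
    field_simp
    ring
  have e1 : ε * q * w = ε * q ^ (1 + 2 * α) := by
    rw [Real.rpow_add hq0, Real.rpow_one, mul_assoc]
  have e2 : ε * q / w = ε * q ^ (1 - 2 * α) := by
    rw [Real.rpow_sub hq0, Real.rpow_one, mul_div_assoc]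
  have e3 : q ^ 2 * w = q ^ (2 + 2 * α) := by
    rw [Real.rpow_add hq0, Real.rpow_two]
  have e4 : q ^ 2 / w = q ^ (2 - 2 * α) := by
    rw [Real.rpow_sub hq0, Real.rpow_two]
  rw [← h1, heq, e0, e1, e2, e3, e4]

/-- The alternating sum has no zero between `-1 / 2` and `1 / 2`: its product has positive
factors there. -/
theorem sechSum_neg_one_pos {x α : ℝ} (hx : 0 < x) (h1 : -(1 / 2) < α) (h2 : α < 1 / 2) :
    0 < sechSum (-1) x α := by
  set q := Real.exp (-x) with hq
  have hq0 : 0 < q := Real.exp_pos _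
  have hq1 : q < 1 := Real.exp_lt_one_iff.2 (by linarith)
  have hp0 : 0 < q ^ 2 := by positivity
  have hp1 : q ^ 2 < 1 := pow_lt_one₀ hq0.le hq1 two_ne_zero
  have hxq : -Real.log q = x := by rw [hq, Real.log_exp, neg_neg]
  have h := sechSum_mul_eq_product (ε := -1) hq0 hq1 (by norm_num) α
  rw [hxq] at h
  simp only [neg_mul, one_mul, neg_neg] at h
  have hneg (β : ℝ) : 0 < qShiftedFactorialInf (-q ^ β) (q ^ 2) :=
    qShiftedFactorialInf_pos (by have := Real.rpow_pos_of_pos hq0 β; linarith) hp0 hp1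
  have hlt {β : ℝ} (hβ : 0 < β) : 0 < qShiftedFactorialInf (q ^ β) (q ^ 2) :=
    qShiftedFactorialInf_pos (Real.rpow_lt_one hq0.le hq1 hβ) hp0 hp1
  have ha := Real.rpow_pos_of_pos hq0 α
  have hb := Real.rpow_pos_of_pos hq0 (-α)
  have hR := mul_pos (one_div_pos.2 (add_pos ha hb))
    (div_pos (mul_pos (hlt (β := 1 + 2 * α) (by linarith)) (hlt (β := 1 - 2 * α) (by linarith)))
      (mul_pos (hneg (2 + 2 * α)) (hneg (2 - 2 * α))))
  rw [← h] at hR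
  have := pos_of_mul_pos_left hR (sq_nonneg _)
  linarith

end ProductLimit

/-! ### The secant sum as a Jacobi function -/

section Dn

open Filter Topology

/-- A linear equation `w'' = m w` with continuous `m` has only the zero solution with vanishing
initial data. -/
theorem eq_zero_of_deriv_deriv_eq_mul {w w' m : ℝ → ℝ} (hm : Continuous m)
    (h1 : ∀ t, HasDerivAt w (w' t) t) (h2 : ∀ t, HasDerivAt w' (m t * w t) t)
    (h3 : w 0 = 0) (h4 : w' 0 = 0) (t : ℝ) : w t = 0 := by
  set T := |t| + 1 with hT
  have hT0 : 0 < T := by positivity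
  obtain ⟨C, hC⟩ := (isCompact_Icc (a := -T) (b := T)).exists_bound_of_continuousOn hm.continuousOn
  have hlip : ∀ s ∈ Set.Ioo (-T) T, LipschitzOnWith (Real.toNNReal (max 1 C))
      (fun p : ℝ × ℝ => (p.2, m s * p.1)) Set.univ := by
    intro s hs
    refine LipschitzOnWith.of_dist_le_mul fun p _ r _ => ?_
    have hmax : 0 ≤ max 1 C := zero_le_one.trans (le_max_left _ _)
    have hms : |m s| ≤ max 1 C := (hC s (Set.Ioo_subset_Icc_self hs)).trans (le_max_right _ _)
    rw [Real.coe_toNNReal _ hmax, dist_eq_norm, dist_eq_norm, Prod.norm_def]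
    refine max_le ?_ ?_
    · calc ‖p.2 - r.2‖ ≤ ‖p - r‖ := norm_snd_le (p - r)
        _ ≤ max 1 C * ‖p - r‖ := le_mul_of_one_le_left (norm_nonneg _) (le_max_left _ _)
    · calc ‖m s * p.1 - m s * r.1‖ = |m s| * ‖p.1 - r.1‖ := by
            rw [← mul_sub, norm_mul, Real.norm_eq_abs]
        _ ≤ max 1 C * ‖p - r‖ :=
            mul_le_mul hms (norm_fst_le (p - r)) (norm_nonneg _) hmax
  have heq := ODE_solution_unique_of_mem_Ioo (v := fun s (p : ℝ × ℝ) => (p.2, m s * p.1))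
    (s := fun _ => Set.univ) (f := fun s => (w s, w' s)) (g := fun _ => (0, 0)) (t₀ := 0) hlip
    ⟨by linarith, hT0⟩ (fun s _ => ⟨(h1 s).prodMk (h2 s), trivial⟩)
    (fun s _ => ⟨(hasDerivAt_const s ((0 : ℝ), (0 : ℝ))).congr_deriv (by ext <;> simp), trivial⟩)
    (by simp [h3, h4])
  have ht : t ∈ Set.Ioo (-T) T := by
    rw [Set.mem_Ioo, ← abs_lt]; linarith
  exact congrArg Prod.fst (heq ht)

/-- Solutions of `y'' = β y - γ y³` are determined by their initial data. -/
theorem eq_of_duffing {y y' z z' : ℝ → ℝ} {β γ : ℝ}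
    (hy : ∀ t, HasDerivAt y (y' t) t) (hy' : ∀ t, HasDerivAt y' (β * y t - γ * y t ^ 3) t)
    (hz : ∀ t, HasDerivAt z (z' t) t) (hz' : ∀ t, HasDerivAt z' (β * z t - γ * z t ^ 3) t)
    (h0 : y 0 = z 0) (h0' : y' 0 = z' 0) (t : ℝ) : y t = z t := by
  have hyc : Continuous y := continuous_iff_continuousAt.2 fun t => (hy t).continuousAt
  have hzc : Continuous z := continuous_iff_continuousAt.2 fun t => (hz t).continuousAt
  refine sub_eq_zero.1 (eq_zero_of_deriv_deriv_eq_mul (w := fun t => y t - z t)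
    (w' := fun t => y' t - z' t) (m := fun t => β - γ * (y t ^ 2 + y t * z t + z t ^ 2))
    (by fun_prop) (fun t => (hy t).sub (hz t)) (fun t => ?_) (sub_eq_zero.2 h0)
    (sub_eq_zero.2 h0') t)
  exact ((hy' t).sub (hz' t)).congr_deriv (by ring)

variable {x : ℝ}

/-- The modulus `θ₂² / θ₃²` attached to the nome `exp (-x)`, as a quotient of secant sums. -/
noncomputable def sechModulus (x : ℝ) : ℝ := sechSum 1 x (1 / 2) / sechSum 1 x 0

theorem sechModulus_pos (hx : 0 < x) : 0 < sechModulus x :=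
  div_pos (sechSum_one_pos hx _) (sechSum_one_pos hx _)

theorem sechSum_neg_one_zero_pos (hx : 0 < x) : 0 < sechSum (-1) x 0 :=
  sechSum_neg_one_pos hx (by norm_num) (by norm_num)

theorem one_sub_sechModulus_sq (hx : 0 < x) :
    1 - sechModulus x ^ 2 = (sechSum (-1) x 0 / sechSum 1 x 0) ^ 2 := by
  have ha := (sechSum_one_pos hx 0).ne'
  have h := sechSum_one_sq hx 0
  rw [sechModulus]
  field_simp
  linarith

theorem sechModulus_mem (hx : 0 < x) : sechModulus x ∈ Set.Ioo (0 : ℝ) 1 := by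
  refine ⟨sechModulus_pos hx, ?_⟩
  have h := one_sub_sechModulus_sq hx
  have h2 := pow_pos (div_pos (sechSum_neg_one_zero_pos hx) (sechSum_one_pos hx 0)) 2
  exact lt_of_pow_lt_pow_left₀ 2 zero_le_one (by linarith)

theorem abs_complementaryModulus_sechModulus_lt_one (hx : 0 < x) :
    |complementaryModulus (sechModulus x)| < 1 := by
  have h := complementaryModulus_mem (sechModulus_mem hx)
  rw [abs_of_pos h.1]
  exact h.2

/-- Both sides solve the same second order equation with the same initial data. -/
theorem sechSum_one_eq_jacobiDn (hx : 0 < x) (α : ℝ) :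
    sechSum 1 x α = sechSum 1 x 0 *
      jacobiDn (x * sechSum 1 x 0 * α) (complementaryModulus (sechModulus x)) := by
  have hκ := abs_complementaryModulus_sechModulus_lt_one hx
  have hκ2 : complementaryModulus (sechModulus x) ^ 2 = 1 - sechModulus x ^ 2 :=
    Real.sq_sqrt (by rw [one_sub_sechModulus_sq hx]; positivity)
  have ha := (sechSum_one_pos hx 0).ne'
  have hb : sechSum 1 x (1 / 2) = sechModulus x * sechSum 1 x 0 := by
    rw [sechModulus, div_mul_cancel₀ _ ha]
  set κ := complementaryModulus (sechModulus x) with hκdef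
  set a := sechSum 1 x 0 with hadef
  have hlin (t : ℝ) : HasDerivAt (fun t => x * a * t) (x * a) t := by
    simpa using (hasDerivAt_id t).const_mul (x * a)
  refine eq_of_duffing (y' := sechSumDeriv x)
    (z := fun α => a * jacobiDn (x * a * α) κ)
    (z' := fun α => a * (-κ ^ 2 * Real.sin (jacobiAm (x * a * α) κ) *
      Real.cos (jacobiAm (x * a * α) κ) * (x * a)))
    (β := x ^ 2 * (a ^ 2 + sechSum 1 x (1 / 2) ^ 2)) (γ := 2 * x ^ 2)
    (hasDerivAt_sechSum_one hx)
    (hasDerivAt_sechSumDeriv hx (sechSum_neg_one_zero_pos hx).ne')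
    (fun t => ((hasDerivAt_jacobiDn hκ (x * a * t)).comp t (hlin t)).const_mul a)
    (fun t => ?_) ?_ ?_ α
  · refine ((((hasDerivAt_deriv_jacobiDn hκ (x * a * t)).comp t (hlin t)).mul_const
      (x * a)).const_mul a).congr_deriv ?_
    rw [hb, hκ2]
    ring
  · simp [jacobiDn_zero hκ, hadef]
  · simp [jacobiAm_zero hκ, sechSumDeriv_zero hx]

/-- `K(k') = x a / 2` with `a = ∑_n sech (x n)`: the secant sum reaches its minimum for the first
time at `1 / 2`, and `dn` at `K`. -/
theorem ellipticIntegralK'_sechModulus (hx : 0 < x) :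
    ellipticIntegralK' (sechModulus x) = x * sechSum 1 x 0 / 2 := by
  have hκ := abs_complementaryModulus_sechModulus_lt_one hx
  have hκpos := (complementaryModulus_mem (sechModulus_mem hx)).1
  have hκ2 : complementaryModulus (sechModulus x) ^ 2 = 1 - sechModulus x ^ 2 :=
    Real.sq_sqrt (by rw [one_sub_sechModulus_sq hx]; positivity)
  have ha := sechSum_one_pos hx 0
  have hb : sechSum 1 x (1 / 2) = sechModulus x * sechSum 1 x 0 := by
    rw [sechModulus, div_mul_cancel₀ _ ha.ne']
  have hdn := sechSum_one_eq_jacobiDn hx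
  have hsq := sechSum_one_sq hx
  rw [ellipticIntegralK']
  set κ := complementaryModulus (sechModulus x) with hκdef
  set a := sechSum 1 x 0 with hadef
  have hK := ellipticIntegralK_pos hκ
  have hamK : jacobiAm (ellipticIntegralK κ) κ = Real.pi / 2 := jacobiAm_ellipticIntegralF hκ _
  have hxa : 0 < x * a := mul_pos hx ha
  -- the quarter period corresponds to a zero of the alternating sum
  have hle : x * a / 2 ≤ ellipticIntegralK κ := by
    by_contra! hlt
    have hα : 0 < ellipticIntegralK κ / (x * a) := div_pos hK hxa
    have hα2 : ellipticIntegralK κ / (x * a) < 1 / 2 := by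
      rw [div_lt_iff₀ hxa]; linarith
    have h1 := hsq (ellipticIntegralK κ / (x * a))
    rw [hdn (ellipticIntegralK κ / (x * a)), mul_div_cancel₀ _ hxa.ne', mul_pow, jacobiDn_sq hκ,
      hamK, Real.sin_pi_div_two, hκ2, hb] at h1
    have h2 := pow_pos (sechSum_neg_one_pos hx (by linarith) hα2) 2
    nlinarith
  have hhalf : Real.sin (jacobiAm (x * a / 2) κ) ^ 2 = 1 := by
    have h1 := hdn (1 / 2)
    rw [hb, mul_comm, mul_right_inj' ha.ne', show x * a * (1 / 2) = x * a / 2 by ring] at h1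
    have h2 := jacobiDn_sq hκ (x * a / 2)
    rw [← h1] at h2
    have h3 : κ ^ 2 * (Real.sin (jacobiAm (x * a / 2) κ) ^ 2 - 1) = 0 := by linarith
    rcases mul_eq_zero.1 h3 with h | h
    · exact absurd h (by positivity)
    · linarith
  have ham1 : 0 < jacobiAm (x * a / 2) κ := by
    have := strictMono_jacobiAm hκ (half_pos hxa)
    simpa [jacobiAm_zero hκ] using this
  have ham2 : jacobiAm (x * a / 2) κ ≤ Real.pi / 2 := by
    rw [← hamK]; exact (strictMono_jacobiAm hκ).monotone hle
  have ham : jacobiAm (x * a / 2) κ = Real.pi / 2 := by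
    by_contra hne
    have hlt := lt_of_le_of_ne ham2 hne
    have hs0 := Real.sin_pos_of_pos_of_lt_pi ham1 (by linarith [Real.pi_pos])
    have hc := Real.cos_pos_of_mem_Ioo ⟨by linarith, hlt⟩
    nlinarith [Real.sin_sq_add_cos_sq (jacobiAm (x * a / 2) κ)]
  have := ellipticIntegralF_jacobiAm hκ (x * a / 2)
  rw [ham] at this
  exact this

/-- The secant sums at `0` follow the arithmetic-geometric mean iteration when `x` is doubled, and
tend to `1`; hence the Gauss integral attached to them is `π / 2`. -/
theorem gaussIntegral_sechSum (hx : 0 < x) :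
    gaussIntegral (sechSum 1 x 0) (sechSum (-1) x 0) = Real.pi / 2 := by
  have hstep {y : ℝ} (hy : 0 < y) :
      gaussIntegral (sechSum 1 (2 * y) 0) (sechSum (-1) (2 * y) 0) =
        gaussIntegral (sechSum 1 y 0) (sechSum (-1) y 0) := by
    have h1 := sechSum_one_pos hy 0
    have h2 := sechSum_neg_one_zero_pos hy
    have h3 := sechSum_neg_one_zero_pos (mul_pos two_pos hy)
    rw [← gaussIntegral_agm h1 h2, ← sechSum_two_mul hy, ← sechSum_neg_one_two_mul_sq hy,
      Real.sqrt_sq h3.le]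
  have hpow (m : ℕ) : 0 < 2 ^ m * x := by positivity
  have hconst (m : ℕ) : gaussIntegral (sechSum 1 (2 ^ m * x) 0) (sechSum (-1) (2 ^ m * x) 0) =
      gaussIntegral (sechSum 1 x 0) (sechSum (-1) x 0) := by
    induction m with
    | zero => simp
    | succ m ih => rw [pow_succ', mul_assoc, hstep (hpow m), ih]
  have htend : Tendsto (fun m : ℕ => 2 ^ m * x) atTop atTop :=
    (tendsto_pow_atTop_atTop_of_one_lt one_lt_two).atTop_mul_const hx
  have hle {y : ℝ} (hy : 0 < y) : sechSum (-1) y 0 ≤ sechSum 1 y 0 := by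
    have h := sechSum_one_sq hy 0
    refine le_of_sq_le_sq ?_ (sechSum_one_pos hy 0).le
    nlinarith [sq_nonneg (sechSum 1 y (1 / 2))]
  have h1 : Tendsto (fun m : ℕ => Real.pi / 2 / sechSum 1 (2 ^ m * x) 0) atTop
      (𝓝 (Real.pi / 2 / 1)) :=
    tendsto_const_nhds.div ((tendsto_sechSum_atTop (by norm_num)).comp htend) one_ne_zero
  have h2 : Tendsto (fun m : ℕ => Real.pi / 2 / sechSum (-1) (2 ^ m * x) 0) atTop
      (𝓝 (Real.pi / 2 / 1)) :=
    tendsto_const_nhds.div ((tendsto_sechSum_atTop (by norm_num)).comp htend) one_ne_zero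
  rw [div_one] at h1 h2
  refine tendsto_nhds_unique tendsto_const_nhds (tendsto_of_tendsto_of_tendsto_of_le_of_le h1 h2
    (fun m => ?_) fun m => ?_)
  · rw [← hconst m]
    exact le_gaussIntegral (sechSum_neg_one_zero_pos (hpow m)) (hle (hpow m))
  · rw [← hconst m]
    exact gaussIntegral_le (sechSum_neg_one_zero_pos (hpow m)) (hle (hpow m))

theorem ellipticIntegralK_sechModulus (hx : 0 < x) :
    ellipticIntegralK (sechModulus x) = sechSum 1 x 0 * (Real.pi / 2) := by
  rw [ellipticIntegralK_eq_gaussIntegral (sechSum_one_pos hx 0) (b := sechSum (-1) x 0),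
    gaussIntegral_sechSum hx]
  have h := one_sub_sechModulus_sq hx
  rw [div_pow] at h
  linarith

/-- The nome of `sechModulus x` is `exp (-x)`. -/
theorem nome_sechModulus (hx : 0 < x) :
    Real.exp (-Real.pi * ellipticIntegralK' (sechModulus x) / ellipticIntegralK (sechModulus x)) =
      Real.exp (-x) := by
  have ha := (sechSum_one_pos hx 0).ne'
  have hpi := Real.pi_ne_zero
  rw [ellipticIntegralK'_sechModulus hx, ellipticIntegralK_sechModulus hx]
  congr 1
  field_simp

end Dn

/-! ### The theorem on the bilateral sum -/

theorem mainTheorem7 (q : ℝ) (hq0 : 0 < q) (hq1 : q < 1) :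
    (∃! k : ℝ, (0 < k ∧ k < 1) ∧
      q = Real.exp (-Real.pi * ellipticIntegralK' k / ellipticIntegralK k)) ∧
    ∀ α : ℝ,
      Summable (bilateralTerm α q) ∧
      bilateralF α q =
        1 / (q ^ α + q ^ (-α)) *
          ((qShiftedFactorialInf (-q ^ (1 + 2 * α)) (q ^ 2) *
              qShiftedFactorialInf (-q ^ (1 - 2 * α)) (q ^ 2) *
              qShiftedFactorialInf (q ^ 2) (q ^ 2) *
              qShiftedFactorialInf (q ^ 2) (q ^ 2)) /
            (qShiftedFactorialInf (-q ^ (2 + 2 * α)) (q ^ 2) *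
              qShiftedFactorialInf (-q ^ (2 - 2 * α)) (q ^ 2) *
              qShiftedFactorialInf q (q ^ 2) *
              qShiftedFactorialInf q (q ^ 2))) ∧
      ∀ k : ℝ, 0 < k → k < 1 →
        q = Real.exp (-Real.pi * ellipticIntegralK' k / ellipticIntegralK k) →
        bilateralF α q =
          ellipticIntegralK k / Real.pi *
            jacobiDn (2 * α * ellipticIntegralK' k) (complementaryModulus k) := by
  have hx : 0 < -Real.log q := neg_pos.2 (Real.log_neg hq0 hq1)
  have hq : Real.exp (-(-Real.log q)) = q := by rw [neg_neg, Real.exp_log hq0]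
  have hnome := (nome_sechModulus hx).trans hq
  have huniq (k : ℝ) (hk : 0 < k ∧ k < 1)
      (hkq : q = Real.exp (-Real.pi * ellipticIntegralK' k / ellipticIntegralK k)) :
      k = sechModulus (-Real.log q) :=
    nome_injOn hk (sechModulus_mem hx) (hkq.symm.trans hnome.symm)
  have hterm (α : ℝ) : bilateralTerm α q = fun n => sechTerm (-Real.log q) α n / 2 :=
    funext (bilateralTerm_eq_sechTerm hq0 α)
  have hF (α : ℝ) : bilateralF α q = sechSum 1 (-Real.log q) α / 2 := by
    rw [bilateralF, hterm, tsum_div_const, sechSum_one]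
  refine ⟨⟨_, ⟨sechModulus_mem hx, hnome.symm⟩, fun k hk => huniq k hk.1 hk.2⟩, fun α =>
    ⟨?_, ?_, fun k hk0 hk1 hkq => ?_⟩⟩
  · rw [hterm]
    exact (summable_sechTerm hx α).div_const 2
  · have hp0 : 0 < q ^ 2 := by positivity
    have hp1 : q ^ 2 < 1 := pow_lt_one₀ hq0.le hq1 two_ne_zero
    have h := sechSum_mul_eq_product (ε := 1) hq0 hq1 (by norm_num) α
    rw [← hF, one_mul, one_mul, one_mul] at h
    have h1 := (qShiftedFactorialInf_pos hq1 hp0 hp1).ne'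
    have h2 := (qShiftedFactorialInf_pos hp1 hp0 hp1).ne'
    rw [eq_div_of_mul_eq (pow_ne_zero 2 (div_ne_zero h1 h2)) h]
    generalize qShiftedFactorialInf q (q ^ 2) = u at *
    generalize qShiftedFactorialInf (q ^ 2) (q ^ 2) = v at *
    simp only [div_eq_mul_inv, mul_inv, mul_pow, inv_pow, inv_inv]
    ring
  · rw [huniq k ⟨hk0, hk1⟩ hkq, hF, sechSum_one_eq_jacobiDn hx,
      ellipticIntegralK_sechModulus hx, ellipticIntegralK'_sechModulus hx,
      show 2 * α * (-Real.log q * sechSum 1 (-Real.log q) 0 / 2) =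
        -Real.log q * sechSum 1 (-Real.log q) 0 * α by ring]
    have := Real.pi_ne_zero
    field_simp
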